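/- Let $A_2=\mathbb C[t_1,t_2]$, $\partial_i=\partial/\partial t_i$, $d_i=t_i\partial_i$ and $d=d_1+d_2$. Let $\bar S_2$ be the Lie algebra of derivations $\sum_i p_i\partial_i$ of $A_2$ ($p_i\in A_2$) with constant divergence $\sum_i\partial_i(p_i)\in\mathbb C$. Put $\bar S_2(k)=\{u\in\bar S_2 : [d,u]=ku\}$ and $\bar S_2^{\ge 0}=\bigoplus_{k\ge 0}\bar S_2(k)$, so that $\bar S_2=\Delta_2\oplus\bar S_2^{\ge0}$ with $\Delta_2=\bar S_2(-1)=\mathbb C\partial_1\oplus\mathbb C\partial_2$. Write $X\mapsto X_{\ge 0}$ for the projection of $\bar S_2$ onto $\bar S_2^{\ge 0}$ along $\Delta_2$. For $r\in\mathbb Z_+^2$ and $X\in\bar S_2$ put $\partial^rX=(\mathrm{ad}\,\partial_1)^{r_1}(\mathrm{ad}\,\partial_2)^{r_2}X$, which is zero for all but finitely many $r$. Let $\widetilde S_2=\bar S_2\ltimes A_2$ be the semidirect product Lie algebra in which $\bar S_2$ acts on the abelian Lie algebra $A_2$ by derivations. An $(A_2,\bar S_2)$-module is an $\widetilde S_2$-module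 $M$ on which $A_2$ acts associatively and unitally: $f(gm)=(fg)m$ and $1m=m$. Fix $\mathbf a=(a_1,a_2)\in\mathbb C^2$ and let $\phi_{\mathbf a}:\Delta_2\to\mathbb C$ be the Lie algebra homomorphism with $\phi_{\mathbf a}(\partial_i)=a_i$. For an $\widetilde S_2$-module $M$ let $\mathrm{Wh}_{\mathbf a}(M)=\{v\in M : xv=\phi_{\mathbf a}(x)v\ \ \forall x\in\Delta_2\}$. Let $\Omega^{\widetilde S_2}_{\mathbf a}$ be the full subcategory of the category of $\widetilde S_2$-modules whose objects are the $(A_2,\bar S_2)$-modules $M$ such that $\Delta_2$ acts locally finitely on $M$, for all $v\in M$ and $x\in\Delta_2$ there is $k$ with $(x-\phi_{\mathbf a}(x))^kv=0$, and $\dim\mathrm{Wh}_{\mathbf a}(M)<\infty$. For an $\bar S_2^{\ge0}$-module $V$ let $T(A_2^{\mathbf a},V)=A_2\otimes V$, where $f\in A_2$ acts by $f(p\otimes v)=fp\otimes v$ and $X=\sum_i p_i\partial_i\in\bar S_2$ acts by $$X(p\otimes v)=\sum_i p_i\,(\partial_i p+a_ip)\otimes v+\sum_{r\in\mathbb Z_+^2}\frac{t^r}{r!}\,p\otimes(\partial^rX)_{\ge0}\,v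 .$$ On a morphism $f$ put $T(A_2^{\mathbf a},f)=\mathrm{id}\otimes f$. Then, for every $\mathbf a\in\mathbb C^2$, the module $T(A_2^{\mathbf a},V)$ lies in $\Omega^{\widetilde S_2}_{\mathbf a}$ for every finite-dimensional $\bar S_2^{\ge0}$-module $V$, and the functor $V\mapsto T(A_2^{\mathbf a},V)$ is an equivalence from the category of finite-dimensional $\bar S_2^{\ge0}$-modules to $\Omega^{\widetilde S_2}_{\mathbf a}$. A quasi-inverse is the functor $M\mapsto\mathrm{Wh}_{\mathbf a}(M)$, where $X\in\bar S_2^{\ge0}$ acts on $\mathrm{Wh}_{\mathbf a}(M)$ by $$X\cdot v=\sum_{r\in\mathbb Z_+^2}(-1)^{|r|}\frac{t^r}{r!}\,\big((\partial^rX)\,v\big),$$ and morphisms are restricted to Whittaker vectors. -/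

import Mathlib

universe w u

namespace WhittakerS2

open MvPolynomial TensorProduct CategoryTheory

/-- The polynomial algebra `A₂ = ℂ[t₁, t₂]`; the variable `t_{i+1}` is `X i`. -/
abbrev A2 : Type := MvPolynomial (Fin 2) ℂ

/-- The Witt algebra `W₂` of derivations of `A₂`. A derivation `D` is `∑ i, D (X i) • ∂_i`. -/
abbrev W2 : Type := Derivation ℂ A2 A2

/-- The divergence `∑ i, ∂_i (p_i)` of `D = ∑ i, p_i ∂_i`. -/
noncomputable def divergence : W2 →ₗ[ℂ] A2 where
  toFun D := ∑ i, pderiv i (D (X i))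
  map_add' D E := by simp [Finset.sum_add_distrib]
  map_smul' c D := by simp

lemma W2_apply (D : W2) (f : A2) : D f = ∑ i, D (X i) * pderiv i f := by
  have h : D = ∑ i, D (X i) • (pderiv i : W2) := by
    refine MvPolynomial.derivation_ext fun j => ?_
    simp [Fin.sum_univ_two, pderiv_X, Pi.single_apply]
    fin_cases j <;> simp
  conv_lhs => rw [h]
  simp [Fin.sum_univ_two]

lemma pderiv_comm' (i j : Fin 2) (f : A2) : pderiv i (pderiv j f) = pderiv j (pderiv i f) := by
  have h : ⁅(pderiv i : W2), (pderiv j : W2)⁆ = 0 := by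
    refine MvPolynomial.derivation_ext fun k => ?_
    rw [Derivation.commutator_apply]
    by_cases h1 : k = i <;> by_cases h2 : k = j <;> simp [pderiv_X, Pi.single_apply, h1, h2] <;> split_ifs <;> simp
  have := congrArg (fun D : W2 => D f) h
  simpa [Derivation.commutator_apply, sub_eq_zero] using this

lemma divergence_lie (D E : W2) :
    divergence ⁅D, E⁆ = D (divergence E) - E (divergence D) := by
  simp only [divergence, LinearMap.coe_mk, AddHom.coe_mk, Derivation.commutator_apply, map_sub,
    map_sum]
  simp only [W2_apply D (E _), W2_apply E (D _), W2_apply D (pderiv _ _), W2_apply E (pderiv _ _)]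
  simp only [Fin.sum_univ_two, map_add, pderiv_mul]
  simp only [pderiv_comm' 1 0]
  ring

/-- The Lie algebra `S̄₂` of derivations of `A₂` with constant divergence. -/
noncomputable def Sbar : LieSubalgebra ℂ W2 where
  carrier := {D | ∃ c : ℂ, divergence D = C c}
  zero_mem' := ⟨0, by simp⟩
  add_mem' := by
    rintro D E ⟨c, hc⟩ ⟨d, hd⟩
    exact ⟨c + d, by simp [hc, hd]⟩
  smul_mem' := by
    rintro r D ⟨c, hc⟩
    exact ⟨r * c, by simp [hc, smul_eq_C_mul]⟩
  lie_mem' := by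
    rintro D E ⟨c, hc⟩ ⟨d, hd⟩
    refine ⟨0, ?_⟩
    rw [divergence_lie, hc, hd]; simp

/-- `∂_i` as an element of `S̄₂`. -/
noncomputable def partialS (i : Fin 2) : Sbar :=
  ⟨pderiv i, 0, by
    simp only [divergence, LinearMap.coe_mk, AddHom.coe_mk, Fin.sum_univ_two, pderiv_X]
    fin_cases i <;> simp⟩

/-- `d = t₁∂₁ + t₂∂₂` as an element of `S̄₂`. -/
noncomputable def eulerS : Sbar :=
  ⟨∑ i, (X i : A2) • (pderiv i : W2), 2, by
    simp [divergence, Fin.sum_univ_two, pderiv_X, map_ofNat]; norm_num⟩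

/-- The homogeneous part `S̄₂(k) = {u | [d, u] = k u}`. -/
noncomputable def gradeS (k : ℤ) : Submodule ℂ Sbar where
  carrier := {u | ⁅eulerS, u⁆ = (k : ℂ) • u}
  zero_mem' := by simp
  add_mem' := by
    intro u v hu hv
    simp only [Set.mem_ofPred_eq] at *
    rw [lie_add, hu, hv, smul_add]
  smul_mem' := by
    intro c u hu
    simp only [Set.mem_ofPred_eq] at *
    rw [lie_smul, hu, smul_comm]

/-- The parabolic subalgebra `S̄₂^{≥0} = ⨁_{k ≥ 0} S̄₂(k)`. (Eigenspaces for distinct eigenvalues are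
automatically independent, so the sum is direct.) -/
noncomputable def SbarGE : LieSubalgebra ℂ Sbar where
  toSubmodule := ⨆ k : ℕ, gradeS k
  lie_mem' := by
    intro x y hx hy
    change x ∈ ⨆ k : ℕ, gradeS k at hx
    change y ∈ ⨆ k : ℕ, gradeS k at hy
    change ⁅x, y⁆ ∈ ⨆ k : ℕ, gradeS k
    induction hx using Submodule.iSup_induction' with
    | mem i x hx =>
      induction hy using Submodule.iSup_induction' with
      | mem j y hy =>
        refine Submodule.mem_iSup_of_mem (i + j) ?_
        change ⁅eulerS, x⁆ = ((i : ℤ) : ℂ) • x at hx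
        change ⁅eulerS, y⁆ = ((j : ℤ) : ℂ) • y at hy
        change ⁅eulerS, ⁅x, y⁆⁆ = (((i + j : ℕ) : ℤ) : ℂ) • ⁅x, y⁆
        rw [leibniz_lie, hx, hy, smul_lie, lie_smul, ← add_smul]
        push_cast; rfl
      | zero => simp
      | add a b _ _ ha hb => rw [lie_add]; exact add_mem ha hb
    | zero => simp
    | add a b _ _ ha hb => rw [add_lie]; exact add_mem ha hb

/-- The coefficient `p_i` of `D = ∑ i, p_i ∂_i`. -/
noncomputable def component (i : Fin 2) : Sbar →ₗ[ℂ] A2 where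
  toFun D := D.1 (X i)
  map_add' _ _ := rfl
  map_smul' _ _ := rfl

/-- The value at the origin of the coefficient `p_i` of `D = ∑ i, p_i ∂_i`. -/
noncomputable def atOrigin (i : Fin 2) : Sbar →ₗ[ℂ] ℂ :=
  lcoeff ℂ 0 ∘ₗ component i

lemma atOrigin_apply (i : Fin 2) (D : Sbar) : atOrigin i D = coeff 0 (D.1 (X i)) := rfl

lemma Sbar_ext {D E : Sbar} (h : ∀ i, D.1 (X i) = E.1 (X i)) : D = E :=
  Subtype.ext (MvPolynomial.derivation_ext h)

lemma lie_apply_X (D E : Sbar) (i : Fin 2) :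
    (⁅D, E⁆ : Sbar).1 (X i) = D.1 (E.1 (X i)) - E.1 (D.1 (X i)) := rfl

lemma euler_apply (f : A2) : eulerS.1 f = ∑ i, X i * pderiv i f := by
  simp [eulerS]

/-- The part of degree `k` of a vector field with constant divergence. -/
noncomputable def homComp (k : ℕ) (D : Sbar) : Sbar :=
  ⟨mkDerivation ℂ fun i => homogeneousComponent (k + 1) (D.1 (X i)), by
    obtain ⟨D, c, hc⟩ := D
    have key : ∀ f : A2, ∀ i, pderiv i (homogeneousComponent (k + 1) f)
        = homogeneousComponent k (pderiv i f) := by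
      intro f i
      ext m
      simp only [coeff_pderiv, coeff_homogeneousComponent]
      simp only [map_add, Finsupp.degree_single, add_left_inj]
      split_ifs <;> simp
    refine ⟨if k = 0 then c else 0, ?_⟩
    have : divergence (mkDerivation ℂ fun i => homogeneousComponent (k + 1) (D (X i)))
        = homogeneousComponent k (divergence D) := by
      simp [divergence, key]
    change divergence (mkDerivation ℂ fun i => homogeneousComponent (k + 1) (D (X i))) = _
    rw [this, hc, homogeneousComponent_of_mem (isHomogeneous_C _ c)]
    split_ifs <;> simp⟩

lemma mem_SbarGE {D : Sbar} (h : ∀ i, atOrigin i D = 0) : D ∈ SbarGE := by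
  have hgr : ∀ k : ℕ, homComp k D ∈ gradeS k := by
    intro k
    change ⁅eulerS, homComp k D⁆ = ((k : ℤ) : ℂ) • homComp k D
    refine Sbar_ext fun i => ?_
    rw [lie_apply_X, euler_apply]
    have h1 : eulerS.1 (X i) = X i := by
      rw [euler_apply]; simp only [Fin.sum_univ_two, pderiv_X]; fin_cases i <;> simp
    have h2 : (homComp k D).1 (X i) = homogeneousComponent (k + 1) (D.1 (X i)) := by
      simp [homComp, mkDerivation_X]
    rw [h1, h2, (homogeneousComponent_isHomogeneous (k+1) _).sum_X_mul_pderiv]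
    change _ = ((k : ℤ) : ℂ) • (homComp k D).1 (X i)
    rw [h2]
    simp [add_smul, smul_eq_C_mul]
  have hsum : D = ∑ k ∈ Finset.range ((D.1 (X 0)).totalDegree + (D.1 (X 1)).totalDegree), homComp k D := by
    refine Sbar_ext fun i => ?_
    have h3 : component i (∑ k ∈ Finset.range ((D.1 (X 0)).totalDegree +
        (D.1 (X 1)).totalDegree), homComp k D)
        = ∑ k ∈ Finset.range ((D.1 (X 0)).totalDegree + (D.1 (X 1)).totalDegree),
          (homogeneousComponent (k+1) (D.1 (X i))) := by
      rw [map_sum]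
      exact Finset.sum_congr rfl fun k _ => by simp [component, homComp, mkDerivation_X]
    change _ = component i _
    rw [h3]
    ext m
    simp only [coeff_sum, coeff_homogeneousComponent]
    by_cases hm : m = 0
    · have := h i
      rw [atOrigin_apply] at this
      subst hm
      simp [this]
    · have hm' : m.degree ≠ 0 := by simpa [Finsupp.degree_eq_zero_iff] using hm
      obtain ⟨n, hn⟩ := Nat.exists_eq_succ_of_ne_zero hm'
      simp only [hn, Nat.succ_eq_add_one, add_left_inj]
      rw [Finset.sum_ite_eq]
      split_ifs with hlt
      · rfl
      · apply coeff_eq_zero_of_totalDegree_lt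
        rw [Finset.mem_range] at hlt
        have : m.degree = ∑ i ∈ m.support, m i := rfl
        rw [← this, hn]
        fin_cases i <;> simp <;> omega
  rw [hsum]
  exact sum_mem fun k _ => Submodule.mem_iSup_of_mem (p := fun k : ℕ => gradeS k) k (hgr k)

lemma atOrigin_of_mem {D : Sbar} (h : D ∈ SbarGE) (i : Fin 2) : atOrigin i D = 0 := by
  change D ∈ ⨆ k : ℕ, gradeS k at h
  induction h using Submodule.iSup_induction' with
  | mem k D hD =>
    change ⁅eulerS, D⁆ = ((k : ℤ) : ℂ) • D at hD
    have := congrArg (atOrigin i) hD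
    have h1 : eulerS.1 (X i) = X i := by
      rw [euler_apply]; simp only [Fin.sum_univ_two, pderiv_X]; fin_cases i <;> simp
    rw [map_smul, atOrigin_apply, atOrigin_apply, lie_apply_X, euler_apply, h1] at this
    rw [atOrigin_apply]
    simp only [← constantCoeff_eq, map_sub, map_sum, map_mul, constantCoeff_X] at this
    simp only [← constantCoeff_eq]
    simp at this
    have hk : ((k : ℂ) + 1) ≠ 0 := by exact_mod_cast Nat.succ_ne_zero k
    have h2 : ((k : ℂ) + 1) * constantCoeff (D.1 (X i)) = 0 := by linear_combination -this
    exact (mul_eq_zero.mp h2).resolve_left hk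
  | zero => simp
  | add a b _ _ ha hb => rw [map_add, ha, hb, add_zero]


/-- `ad ∂_i` on `S̄₂`; it differentiates the coefficients of a vector field. -/
noncomputable def adPartial (i : Fin 2) : Module.End ℂ Sbar := LieAlgebra.ad ℂ Sbar (partialS i)

lemma component_adPartial (i j : Fin 2) (D : Sbar) :
    component j (adPartial i D) = pderiv i (component j D) := by
  change (⁅partialS i, D⁆ : Sbar).1 (X j) = pderiv i (D.1 (X j))
  rw [lie_apply_X]
  change pderiv i (D.1 (X j)) - D.1 (pderiv i (X j)) = _
  rw [pderiv_X, Pi.single_apply]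
  split_ifs <;> simp

lemma adPartial_comm (i j : Fin 2) : Commute (adPartial i) (adPartial j) := by
  refine LinearMap.ext fun D => Sbar_ext fun k => ?_
  change component k (adPartial i (adPartial j D)) = component k (adPartial j (adPartial i D))
  simp only [component_adPartial]
  exact pderiv_comm' _ _ _

/-- `∂^r D := (ad ∂₁)^{r₁} (ad ∂₂)^{r₂} D`. -/
noncomputable def iterAd (r : Fin 2 →₀ ℕ) : Module.End ℂ Sbar :=
  adPartial 0 ^ r 0 * adPartial 1 ^ r 1

lemma iterAd_zero : iterAd 0 = 1 := by simp [iterAd]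

lemma iterAd_add_single (r : Fin 2 →₀ ℕ) (i : Fin 2) :
    iterAd (r + Finsupp.single i 1) = adPartial i * iterAd r := by
  fin_cases i
  · simp [iterAd, pow_succ', mul_assoc]
  · simp only [iterAd, Finsupp.add_apply]
    simp [pow_succ']
    rw [← mul_assoc, ← mul_assoc, ((adPartial_comm 0 1).pow_left _).eq]

lemma adPartial_locally_nilpotent (i : Fin 2) (D : Sbar) :
    ∃ N : ℕ, ∀ n ≥ N, (adPartial i ^ n) D = 0 := by
  have h : ∀ (n : ℕ) (f : A2) (m : Fin 2 →₀ ℕ), f.totalDegree < n →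
      coeff m ((pderiv i)^[n] f) = 0 := by
    have h' : ∀ (n : ℕ) (f : A2), (∀ m : Fin 2 →₀ ℕ, n ≤ m i → coeff m f = 0) →
        (pderiv i)^[n] f = 0 := by
      intro n
      induction n with
      | zero => intro f hf; ext m; simpa using hf m (Nat.zero_le _)
      | succ n ih =>
        intro f hf
        rw [Function.iterate_succ_apply]
        refine ih _ fun m hm => ?_
        rw [coeff_pderiv, hf _ (by simpa using hm), zero_mul]
    intro n f m hn
    rw [h' n f, coeff_zero]
    intro m hm
    apply coeff_eq_zero_of_totalDegree_lt
    refine lt_of_lt_of_le hn (hm.trans ?_)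
    exact Finsupp.le_degree i m
  refine ⟨(component 0 D).totalDegree + (component 1 D).totalDegree + 1, fun n hn => ?_⟩
  refine Sbar_ext fun j => ?_
  change component j _ = component j 0
  have h2 : ∀ (n : ℕ) (D : Sbar), component j ((adPartial i ^ n) D)
      = (pderiv i)^[n] (component j D) := by
    intro n
    induction n with
    | zero => intro D; simp
    | succ n ih =>
      intro D
      rw [pow_succ, Module.End.mul_apply, ih, component_adPartial, Function.iterate_succ_apply]
  rw [h2, map_zero]
  ext m
  rw [h n _ m, coeff_zero]
  fin_cases j <;> simp <;> omega

lemma iterAd_finite (D : Sbar) : {r : Fin 2 →₀ ℕ | iterAd r D ≠ 0}.Finite := by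
  obtain ⟨N, hN⟩ := adPartial_locally_nilpotent 0 D
  obtain ⟨M, hM⟩ := adPartial_locally_nilpotent 1 D
  refine (Set.finite_Iic (Finsupp.single 0 N + Finsupp.single 1 M)).subset fun r hr => ?_
  rw [Set.mem_Iic, Finsupp.le_def]
  intro i
  by_contra hlt
  apply hr
  fin_cases i
  · simp at hlt
    rw [iterAd, ((adPartial_comm 0 1).pow_pow _ _).eq, Module.End.mul_apply, hN _ hlt.le, map_zero]
  · simp at hlt
    rw [iterAd, Module.End.mul_apply, hM _ hlt.le, map_zero]

/-- The (finite) Taylor sum `∑_r c^{|r|} (t^r / r!) ⊗ ∂^r D` in `A₂ ⊗ S̄₂`. On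
`L_α = (1+α₂) t^{α+e₁} ∂₁ - (1+α₁) t^{α+e₂} ∂₂` and `c = 1` it is
`∑_{0 ≤ r ≤ α+e₁+e₂} binom(α+e₁+e₂, r) t^r ⊗ L_{α-r}`. -/
noncomputable def taylor (c : ℂ) (D : Sbar) : A2 ⊗[ℂ] Sbar :=
  ∑ᶠ r : Fin 2 →₀ ℕ,
    (monomial r (c ^ r.degree / ((r 0).factorial * (r 1).factorial)) : A2) ⊗ₜ[ℂ] iterAd r D

section coeffs
variable {L : Type*} [AddCommGroup L] [Module ℂ L]

/-- The coefficient of `t^r` of an element of `A₂ ⊗ L = L[t₁, t₂]`. -/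
noncomputable def tcoeff (r : Fin 2 →₀ ℕ) : A2 ⊗[ℂ] L →ₗ[ℂ] L :=
  (TensorProduct.lid ℂ L).toLinearMap ∘ₗ LinearMap.rTensor L (lcoeff ℂ r)

lemma tcoeff_tmul (r : Fin 2 →₀ ℕ) (f : A2) (x : L) : tcoeff r (f ⊗ₜ[ℂ] x) = coeff r f • x := rfl

lemma tcoeff_ext {z w : A2 ⊗[ℂ] L} (h : ∀ r, tcoeff r z = tcoeff r w) : z = w := by
  classical
  apply (TensorProduct.equivFinsuppOfBasisLeft (basisMonomials (Fin 2) ℂ) (N := L)).injective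
  ext r
  rw [TensorProduct.equivFinsuppOfBasisLeft_apply, TensorProduct.equivFinsuppOfBasisLeft_apply]
  exact h r

lemma tcoeff_pderiv (r : Fin 2 →₀ ℕ) (i : Fin 2) (z : A2 ⊗[ℂ] L) :
    tcoeff r (LinearMap.rTensor L (pderiv i : W2).toLinearMap z) =
      ((r i : ℂ) + 1) • tcoeff (r + Finsupp.single i 1) z := by
  induction z with
  | zero => simp
  | tmul f x =>
    simp only [LinearMap.rTensor_tmul, tcoeff_tmul, Derivation.coeFn_coe, coeff_pderiv, smul_smul,
      mul_comm]
  | add a b ha hb => simp only [map_add, smul_add, ha, hb]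

lemma tcoeff_lTensor {L' : Type*} [AddCommGroup L'] [Module ℂ L'] (g : L →ₗ[ℂ] L')
    (r : Fin 2 →₀ ℕ) (z : A2 ⊗[ℂ] L) :
    tcoeff r (LinearMap.lTensor A2 g z) = g (tcoeff r z) := by
  induction z with
  | zero => simp
  | tmul f x => simp [tcoeff_tmul]
  | add a b ha hb => simp only [map_add, ha, hb]

lemma multi_induction {P : (Fin 2 →₀ ℕ) → Prop} (h0 : P 0)
    (hs : ∀ r i, P r → P (r + Finsupp.single i 1)) (r : Fin 2 →₀ ℕ) : P r := by
  have key : ∀ (i : Fin 2) (n : ℕ) (s : Fin 2 →₀ ℕ), P s → P (s + Finsupp.single i n) := by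
    intro i n
    induction n with
    | zero => intro s hs; simpa using hs
    | succ n ih =>
      intro s hs'
      rw [Finsupp.single_add, ← add_assoc]
      exact hs _ _ (ih s hs')
  have hr : r = 0 + Finsupp.single 0 (r 0) + Finsupp.single 1 (r 1) := by
    ext i; fin_cases i <;> simp
  rw [hr]
  exact key _ _ _ (key _ _ _ h0)

end coeffs

lemma tcoeff_taylor (c : ℂ) (D : Sbar) (r : Fin 2 →₀ ℕ) :
    tcoeff r (taylor c D) = (c ^ r.degree / ((r 0).factorial * (r 1).factorial)) • iterAd r D := by
  rw [taylor, show ∀ z, tcoeff r z = (tcoeff r).toAddMonoidHom z from fun _ => rfl,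
    AddMonoidHom.map_finsum]
  · rw [finsum_eq_single _ r]
    · simp [tcoeff_tmul]
    · intro s hs
      simp [tcoeff_tmul, coeff_monomial, hs]
  · refine (iterAd_finite D).subset fun s hs hz => hs ?_
    simp only [hz, TensorProduct.tmul_zero]

/-- `taylor c` as a linear map. -/
noncomputable def taylorₗ (c : ℂ) : Sbar →ₗ[ℂ] A2 ⊗[ℂ] Sbar where
  toFun := taylor c
  map_add' D E := tcoeff_ext fun r => by simp only [map_add, tcoeff_taylor, smul_add]
  map_smul' a D := tcoeff_ext fun r => by
    simp only [map_smul, tcoeff_taylor, RingHom.id_apply]; rw [smul_comm]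

lemma pderiv_taylor (c : ℂ) (D : Sbar) (i : Fin 2) :
    LinearMap.rTensor Sbar (pderiv i : W2).toLinearMap (taylor c D)
      = c • LinearMap.lTensor A2 (adPartial i) (taylor c D) := by
  refine tcoeff_ext fun r => ?_
  rw [tcoeff_pderiv, map_smul, tcoeff_lTensor, tcoeff_taylor, tcoeff_taylor, iterAd_add_single,
    map_smul, smul_smul, smul_smul, Module.End.mul_apply]
  congr 1
  have h0 : ((r 0).factorial : ℂ) ≠ 0 := by exact_mod_cast Nat.factorial_ne_zero _
  have h1 : ((r 1).factorial : ℂ) ≠ 0 := by exact_mod_cast Nat.factorial_ne_zero _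
  have h2 : ((r 0 : ℂ) + 1) ≠ 0 := Nat.cast_add_one_ne_zero _
  have h3 : ((r 1 : ℂ) + 1) ≠ 0 := Nat.cast_add_one_ne_zero _
  fin_cases i <;> simp [Nat.factorial_succ, pow_succ] <;> field_simp

lemma taylor_unique (c : ℂ) (z : A2 ⊗[ℂ] Sbar) (h0 : tcoeff 0 z = 0)
    (h : ∀ i, LinearMap.rTensor Sbar (pderiv i : W2).toLinearMap z
      = c • LinearMap.lTensor A2 (adPartial i) z) : z = 0 := by
  refine tcoeff_ext fun r => ?_
  rw [map_zero]
  induction r using multi_induction with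
  | h0 => exact h0
  | hs r i ih =>
    have := congrArg (tcoeff r) (h i)
    rw [tcoeff_pderiv, map_smul, tcoeff_lTensor, ih, map_zero, smul_zero] at this
    exact (smul_eq_zero.mp this).resolve_left (Nat.cast_add_one_ne_zero _)

/-- For an `L`-module `V`, the action `(f ⊗ x) (g ⊗ v) = f g ⊗ x v` of `A₂ ⊗ L` on `A₂ ⊗ V`. -/
noncomputable def extAct (L V : Type*) [LieRing L] [LieAlgebra ℂ L] [AddCommGroup V] [Module ℂ V]
    [LieRingModule L V] [LieModule ℂ L V] :
    A2 ⊗[ℂ] L →ₗ[ℂ] A2 ⊗[ℂ] V →ₗ[ℂ] A2 ⊗[ℂ] V :=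
  TensorProduct.map₂ (LinearMap.mul ℂ A2) (LieModule.toEnd ℂ L V : L →ₗ[ℂ] Module.End ℂ V)

section extAct
variable {L V : Type*} [LieRing L] [LieAlgebra ℂ L] [AddCommGroup V] [Module ℂ V]
    [LieRingModule L V] [LieModule ℂ L V]

lemma extAct_tmul (f g : A2) (x : L) (v : V) :
    extAct L V (f ⊗ₜ x) (g ⊗ₜ v) = (f * g) ⊗ₜ[ℂ] ⁅x, v⁆ := rfl

lemma extAct_leibniz (z w : A2 ⊗[ℂ] L) (u : A2 ⊗[ℂ] V) :
    extAct L V z (extAct L V w u) =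
      extAct L V (extAct L L z w) u + extAct L V w (extAct L V z u) := by
  induction z with
  | zero => simp
  | add a b ha hb => simp only [map_add, LinearMap.add_apply, ha, hb]; abel
  | tmul f x =>
    induction w with
    | zero => simp
    | add a b ha hb => simp only [map_add, LinearMap.add_apply, ha, hb]; abel
    | tmul g y =>
      induction u with
      | zero => simp
      | add a b ha hb => simp only [map_add, ha, hb]; abel
      | tmul h v =>
        simp only [extAct_tmul]
        rw [leibniz_lie, TensorProduct.tmul_add, mul_assoc, mul_left_comm g f]

lemma extAct_derivation (D : W2) (z : A2 ⊗[ℂ] L) (u : A2 ⊗[ℂ] V) :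
    LinearMap.rTensor V D.toLinearMap (extAct L V z u) =
      extAct L V (LinearMap.rTensor L D.toLinearMap z) u +
      extAct L V z (LinearMap.rTensor V D.toLinearMap u) := by
  induction z with
  | zero => simp
  | add a b ha hb => simp only [map_add, LinearMap.add_apply, ha, hb]; abel
  | tmul f x =>
    induction u with
    | zero => simp
    | add a b ha hb => simp only [map_add, ha, hb]; abel
    | tmul g y =>
      simp only [extAct_tmul, LinearMap.rTensor_tmul,
        Derivation.coeFn_coe, Derivation.leibniz, smul_eq_mul, TensorProduct.add_tmul]
      rw [add_comm, mul_comm g]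

end extAct

lemma lTensor_lie (i : Fin 2) (z w : A2 ⊗[ℂ] Sbar) :
    LinearMap.lTensor A2 (adPartial i) (extAct Sbar Sbar z w) =
      extAct Sbar Sbar (LinearMap.lTensor A2 (adPartial i) z) w +
      extAct Sbar Sbar z (LinearMap.lTensor A2 (adPartial i) w) := by
  induction z with
  | zero => simp
  | add a b ha hb => simp only [map_add, LinearMap.add_apply, ha, hb]; abel
  | tmul f x =>
    induction w with
    | zero => simp
    | add a b ha hb => simp only [map_add, ha, hb]; abel
    | tmul g y =>
      simp only [extAct_tmul, LinearMap.lTensor_tmul,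
        adPartial, LieAlgebra.ad_apply]
      rw [leibniz_lie, TensorProduct.tmul_add]

lemma tcoeff_zero_lie (z w : A2 ⊗[ℂ] Sbar) :
    tcoeff 0 (extAct Sbar Sbar z w) = ⁅tcoeff 0 z, tcoeff 0 w⁆ := by
  induction z with
  | zero => simp
  | add a b ha hb => simp only [map_add, LinearMap.add_apply, add_lie, ha, hb]
  | tmul f x =>
    induction w with
    | zero => simp
    | add a b ha hb => simp only [map_add, lie_add, ha, hb]
    | tmul g y =>
      simp only [extAct_tmul, tcoeff_tmul, smul_lie, lie_smul, smul_smul]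
      simp only [← constantCoeff_eq, map_mul, mul_comm]

lemma tcoeff_zero_taylor (c : ℂ) (D : Sbar) : tcoeff 0 (taylor c D) = D := by
  rw [tcoeff_taylor, iterAd_zero]; simp

lemma taylor_lie (c : ℂ) (D E : Sbar) :
    taylor c ⁅D, E⁆ = extAct Sbar Sbar (taylor c D) (taylor c E) := by
  rw [← sub_eq_zero]
  refine taylor_unique c _ ?_ fun i => ?_
  · rw [map_sub, tcoeff_zero_lie]; simp only [tcoeff_zero_taylor, sub_self]
  · rw [map_sub, map_sub, extAct_derivation, lTensor_lie]
    simp only [pderiv_taylor, map_smul, LinearMap.smul_apply, smul_sub, smul_add]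

lemma sub_constant_mem (D : Sbar) : D - ∑ i, atOrigin i D • partialS i ∈ SbarGE := by
  refine mem_SbarGE fun j => ?_
  have h : ∀ i, atOrigin j (partialS i) = if j = i then 1 else 0 := by
    intro i
    rw [atOrigin_apply]
    change coeff 0 (pderiv i (X j)) = _
    rw [pderiv_X, Pi.single_apply]
    split_ifs <;> simp
  simp only [map_sub, map_sum, map_smul, h, smul_eq_mul, mul_ite, mul_one, mul_zero,
    Finset.sum_ite_eq, Finset.mem_univ, if_true, sub_self]

/-- The projection `S̄₂ → S̄₂^{≥0}` along `S̄₂(-1) = ℂ∂₁ ⊕ ℂ∂₂`: drop the constant part. -/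
noncomputable def projGE : Sbar →ₗ[ℂ] SbarGE where
  toFun D := ⟨D - ∑ i, atOrigin i D • partialS i, sub_constant_mem D⟩
  map_add' D E := Subtype.ext (by
    change _ = (D - ∑ i, atOrigin i D • partialS i) + (E - ∑ i, atOrigin i E • partialS i)
    simp only [map_add, add_smul, Finset.sum_add_distrib]; abel)
  map_smul' c D := Subtype.ext (by
    change _ = c • (D - ∑ i, atOrigin i D • partialS i)
    simp only [map_smul, smul_sub, Finset.smul_sum, smul_assoc])

lemma projGE_coe (D : Sbar) :
    (projGE D : Sbar) = D - ∑ i, atOrigin i D • partialS i := rfl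

lemma projGE_of_mem (x : SbarGE) : projGE x = x := by
  apply Subtype.ext
  rw [projGE_coe]
  simp [atOrigin_of_mem x.2]

lemma atOrigin_iterAd (j : Fin 2) (r : Fin 2 →₀ ℕ) : ∀ D : Sbar,
    atOrigin j (iterAd r D) = ((r 0).factorial * (r 1).factorial) * coeff r (component j D) := by
  induction r using multi_induction with
  | h0 => intro D; simp [iterAd_zero]; rfl
  | hs r i ih =>
    intro D
    have h : Commute (adPartial i) (iterAd r) :=
      Commute.mul_right ((adPartial_comm i 0).pow_right _) ((adPartial_comm i 1).pow_right _)
    rw [iterAd_add_single, h.eq, Module.End.mul_apply, ih, component_adPartial, coeff_pderiv]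
    fin_cases i <;> simp [Nat.factorial_succ] <;> ring

/-- The element `∑ i, p_i ⊗ ∂_i` of `A₂ ⊗ S̄₂` for `D = ∑ i, p_i ∂_i`. -/
noncomputable def constPart (D : Sbar) : A2 ⊗[ℂ] Sbar := ∑ i, component i D ⊗ₜ[ℂ] partialS i

/-- The `A₂ ⊗ S̄₂^{≥0}` part of the image of `D ∈ S̄₂` under the isomorphism
`A₂ # U(S̄₂) ≅ 𝒟₂ ⊗ U(S̄₂^{≥0})`, namely `∑_r (t^r / r!) ⊗ (∂^r D)_{≥0}`. For `L_α` it is the sum of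
`binom(α+e₁+e₂, r) t^r ⊗ L_{α-r}` over the `r` with `0 ≤ r ≤ α+e₁+e₂` and `|α-r| ≥ 0`; for
`d_i = t_i∂_i` it is `1 ⊗ d_i`. -/
noncomputable def cocycle : Sbar →ₗ[ℂ] A2 ⊗[ℂ] SbarGE :=
  LinearMap.lTensor A2 projGE ∘ₗ taylorₗ 1

lemma cocycle_apply (D : Sbar) : cocycle D = LinearMap.lTensor A2 projGE (taylor 1 D) := rfl

lemma taylor_decomp (D : Sbar) :
    taylor 1 D = LinearMap.lTensor A2 SbarGE.toSubmodule.subtype (cocycle D) + constPart D := by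
  refine tcoeff_ext fun r => ?_
  rw [map_add, tcoeff_lTensor, cocycle_apply, tcoeff_lTensor]
  change _ = ((projGE (tcoeff r (taylor 1 D)) : SbarGE) : Sbar) + _
  rw [projGE_coe]
  have h0 : ((r 0).factorial : ℂ) ≠ 0 := by exact_mod_cast Nat.factorial_ne_zero _
  have h1 : ((r 1).factorial : ℂ) ≠ 0 := by exact_mod_cast Nat.factorial_ne_zero _
  have h : tcoeff r (constPart D) = ∑ i, atOrigin i (tcoeff r (taylor 1 D)) • partialS i := by
    simp only [constPart, map_sum, tcoeff_tmul, tcoeff_taylor, map_smul, atOrigin_iterAd]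
    refine Finset.sum_congr rfl fun i _ => ?_
    congr 1
    simp; field_simp
  rw [h]; abel

lemma extAct_skew {L : Type*} [LieRing L] [LieAlgebra ℂ L] (z w : A2 ⊗[ℂ] L) :
    extAct L L z w = - extAct L L w z := by
  induction z with
  | zero => simp
  | add a b ha hb => simp only [map_add, LinearMap.add_apply, ha, hb]; abel
  | tmul f x =>
    induction w with
    | zero => simp
    | add a b ha hb => simp only [map_add, LinearMap.add_apply, ha, hb]; abel
    | tmul g y =>
      simp only [extAct_tmul]
      rw [← lie_skew, TensorProduct.tmul_neg, mul_comm]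

lemma extAct_tmul_partial (f : A2) (i : Fin 2) (w : A2 ⊗[ℂ] Sbar) :
    extAct Sbar Sbar (f ⊗ₜ partialS i) w = f • LinearMap.lTensor A2 (adPartial i) w := by
  induction w with
  | zero => simp
  | add a b ha hb => simp only [map_add, smul_add, ha, hb]
  | tmul g y => simp [extAct_tmul, adPartial, TensorProduct.smul_tmul']

lemma rTensor_eq_sum {L : Type*} [AddCommGroup L] [Module ℂ L] (D : W2) (z : A2 ⊗[ℂ] L) :
    LinearMap.rTensor L D.toLinearMap z =
      ∑ i, D (X i) • LinearMap.rTensor L (pderiv i : W2).toLinearMap z := by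
  induction z with
  | zero => simp
  | add a b ha hb => simp only [map_add, smul_add, ha, hb, Finset.sum_add_distrib]
  | tmul g y =>
    simp only [LinearMap.rTensor_tmul, Derivation.coeFn_coe, TensorProduct.smul_tmul', smul_eq_mul]
    rw [← TensorProduct.sum_tmul, ← W2_apply]

lemma adPartial_partial (i j : Fin 2) : adPartial i (partialS j) = 0 := by
  refine Sbar_ext fun k => ?_
  change component k (adPartial i (partialS j)) = 0
  rw [component_adPartial]
  change pderiv i (pderiv j (X k)) = 0
  rw [pderiv_X, Pi.single_apply]
  split_ifs <;> simp

lemma extAct_constPart_taylor (D E : Sbar) :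
    extAct Sbar Sbar (constPart D) (taylor 1 E)
      = LinearMap.rTensor Sbar D.1.toLinearMap (taylor 1 E) := by
  rw [rTensor_eq_sum]
  simp only [constPart, map_sum, LinearMap.sum_apply, extAct_tmul_partial]
  refine Finset.sum_congr rfl fun i _ => ?_
  rw [pderiv_taylor, one_smul]; rfl

lemma extAct_constPart_constPart (D E : Sbar) :
    extAct Sbar Sbar (constPart D) (constPart E) = 0 := by
  simp only [constPart, map_sum, LinearMap.sum_apply, extAct_tmul, partialS]
  refine Finset.sum_eq_zero fun i _ => Finset.sum_eq_zero fun j _ => ?_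
  have := adPartial_partial j i
  rw [adPartial, LieAlgebra.ad_apply] at this
  change _ ⊗ₜ[ℂ] ⁅partialS j, partialS i⁆ = 0
  rw [this, TensorProduct.tmul_zero]

lemma projGE_extAct (z w : A2 ⊗[ℂ] SbarGE) :
    LinearMap.lTensor A2 projGE (extAct Sbar Sbar
      (LinearMap.lTensor A2 SbarGE.toSubmodule.subtype z)
      (LinearMap.lTensor A2 SbarGE.toSubmodule.subtype w)) = extAct SbarGE SbarGE z w := by
  induction z with
  | zero => simp
  | add a b ha hb => simp only [map_add, LinearMap.add_apply, ha, hb]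
  | tmul f x =>
    induction w with
    | zero => simp
    | add a b ha hb => simp only [map_add, ha, hb]
    | tmul g y =>
      simp only [extAct_tmul, LinearMap.lTensor_tmul]
      congr 1
      exact projGE_of_mem ⁅x, y⁆

lemma cocycle_lie (D E : Sbar) :
    cocycle ⁅D, E⁆ = extAct SbarGE SbarGE (cocycle D) (cocycle E) +
      LinearMap.rTensor SbarGE D.1.toLinearMap (cocycle E) -
      LinearMap.rTensor SbarGE E.1.toLinearMap (cocycle D) := by
  have hcomm : ∀ (D E : Sbar), LinearMap.lTensor A2 projGE
      (LinearMap.rTensor Sbar D.1.toLinearMap (taylor 1 E)) =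
      LinearMap.rTensor SbarGE D.1.toLinearMap (cocycle E) := by
    intro D E
    rw [cocycle_apply, ← LinearMap.comp_apply, ← LinearMap.comp_apply,
      LinearMap.lTensor_comp_rTensor, LinearMap.rTensor_comp_lTensor]
  rw [← hcomm, ← hcomm, ← projGE_extAct, ← map_add, ← map_sub, cocycle_apply, taylor_lie]
  congr 1
  have hD : LinearMap.lTensor A2 SbarGE.toSubmodule.subtype (cocycle D)
      = taylor 1 D - constPart D := by rw [taylor_decomp D]; abel
  have hE : LinearMap.lTensor A2 SbarGE.toSubmodule.subtype (cocycle E)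
      = taylor 1 E - constPart E := by rw [taylor_decomp E]; abel
  rw [hD, hE]
  simp only [map_sub, LinearMap.sub_apply, extAct_constPart_constPart, extAct_constPart_taylor]
  rw [extAct_skew (taylor 1 D) (constPart E), extAct_constPart_taylor]
  abel

/-- The operator by which the generator `∂_i` of the Weyl algebra `𝒟₂` acts on `A₂^a`, the twist of
`A₂` by `σ_a : t_i ↦ t_i, ∂_i ↦ ∂_i + a_i`; the generators `t_i` act by multiplication. -/
noncomputable def twistedPartial (a : Fin 2 → ℂ) (i : Fin 2) : A2 →ₗ[ℂ] A2 :=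
  (pderiv i : W2).toLinearMap + a i • LinearMap.id

/-- The operator by which `D = ∑ i, p_i ∂_i`, viewed in `𝒟₂`, acts on `A₂^a`. -/
noncomputable def twistedField (a : Fin 2 → ℂ) (D : W2) : A2 →ₗ[ℂ] A2 :=
  ∑ i, LinearMap.mulLeft ℂ (D (X i)) ∘ₗ twistedPartial a i

lemma twistedField_apply (a : Fin 2 → ℂ) (D : W2) (p : A2) :
    twistedField a D p = D p + (∑ i, a i • D (X i)) * p := by
  rw [W2_apply D p]
  simp [twistedField, twistedPartial, Fin.sum_univ_two, smul_eq_C_mul]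
  ring

lemma twistedField_lie (a : Fin 2 → ℂ) (D E : W2) (p : A2) :
    twistedField a ⁅D, E⁆ p =
      twistedField a D (twistedField a E p) - twistedField a E (twistedField a D p) := by
  simp only [twistedField_apply, Derivation.commutator_apply, Fin.sum_univ_two, map_add,
    Derivation.leibniz, smul_eq_mul, smul_eq_C_mul, derivation_C]
  ring

lemma rTensor_twistedField_extAct (a : Fin 2 → ℂ) {V L : Type*} [AddCommGroup V] [Module ℂ V] [LieRing L] [LieAlgebra ℂ L]
    [LieRingModule L V] [LieModule ℂ L V] (D : W2) (z : A2 ⊗[ℂ] L) (u : A2 ⊗[ℂ] V) :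
    LinearMap.rTensor V (twistedField a D) (extAct L V z u) =
      extAct L V (LinearMap.rTensor L D.toLinearMap z) u +
      extAct L V z (LinearMap.rTensor V (twistedField a D) u) := by
  induction z with
  | zero => simp
  | add a b ha hb => simp only [map_add, LinearMap.add_apply, ha, hb]; abel
  | tmul f x =>
    induction u with
    | zero => simp
    | add a b ha hb => simp only [map_add, ha, hb]; abel
    | tmul g y =>
      simp only [extAct_tmul, LinearMap.rTensor_tmul, Derivation.coeFn_coe, twistedField_apply,
        ← TensorProduct.add_tmul, Derivation.leibniz, smul_eq_mul]
      congr 1; ring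

section tensor
variable (a : Fin 2 → ℂ) (V : Type*) [AddCommGroup V] [Module ℂ V]
    [LieRingModule SbarGE V] [LieModule ℂ SbarGE V]

/-- The action of `D ∈ S̄₂` on `T(A₂^a, V) = A₂^a ⊗ V`:
`D (p ⊗ v) = (D p) ⊗ v + ∑_r (t^r / r!) p ⊗ (∂^r D)_{≥0} v`. -/
noncomputable def tensorAct (D : Sbar) : A2 ⊗[ℂ] V →ₗ[ℂ] A2 ⊗[ℂ] V :=
  LinearMap.rTensor V (twistedField a D.1) + extAct SbarGE V (cocycle D)

variable {V}

lemma tensorAct_lie (D E : Sbar) (w : A2 ⊗[ℂ] V) :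
    tensorAct a V ⁅D, E⁆ w =
      tensorAct a V D (tensorAct a V E w) - tensorAct a V E (tensorAct a V D w) := by
  have h : LinearMap.rTensor V (twistedField a ⁅D.1, E.1⁆) w =
      LinearMap.rTensor V (twistedField a D.1) (LinearMap.rTensor V (twistedField a E.1) w) -
      LinearMap.rTensor V (twistedField a E.1) (LinearMap.rTensor V (twistedField a D.1) w) := by
    induction w with
    | zero => simp
    | add a b ha hb => simp only [map_add, ha, hb]; abel
    | tmul g y =>
      simp only [LinearMap.rTensor_tmul, twistedField_lie, TensorProduct.sub_tmul]
  simp only [tensorAct, LinearMap.add_apply, map_add, rTensor_twistedField_extAct, cocycle_lie,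
    map_sub, LinearMap.sub_apply]
  change LinearMap.rTensor V (twistedField a ⁅D.1, E.1⁆) w + _ = _
  rw [h, extAct_leibniz (cocycle D) (cocycle E)]
  abel

lemma tensorAct_add (D E : Sbar) : tensorAct a V (D + E) = tensorAct a V D + tensorAct a V E := by
  ext p v
  simp [tensorAct, twistedField_apply, Finset.sum_add_distrib, add_mul, TensorProduct.add_tmul]
  abel

lemma tensorAct_smul (c : ℂ) (D : Sbar) : tensorAct a V (c • D) = c • tensorAct a V D := by
  ext p v
  have h : ∀ q : A2, twistedField a (c • D.1) q = c • twistedField a D.1 q := by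
    intro q
    simp only [twistedField_apply, Fin.sum_univ_two, Derivation.smul_apply, smul_eq_C_mul]
    ring
  have hc : (c • D : Sbar).1 = c • D.1 := rfl
  simp only [tensorAct, hc, map_smul, TensorProduct.AlgebraTensorModule.curry_apply,
    LinearMap.restrictScalars_self, LinearMap.comp_apply, TensorProduct.curry_apply,
    LinearMap.add_apply, LinearMap.smul_apply, LinearMap.rTensor_tmul, h, smul_add,
    TensorProduct.smul_tmul']

lemma tensorAct_smul_A2 (D : Sbar) (f : A2) (w : A2 ⊗[ℂ] V) :
    tensorAct a V D (f • w) = D.1 f • w + f • tensorAct a V D w := by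
  have h1 : ∀ z : A2 ⊗[ℂ] SbarGE, extAct SbarGE V z (f • w) = f • extAct SbarGE V z w := by
    intro z
    induction z with
    | zero => simp
    | add a b ha hb => simp only [map_add, LinearMap.add_apply, smul_add, ha, hb]
    | tmul g y =>
      induction w with
      | zero => simp
      | add a b ha hb => simp only [smul_add, map_add, ha, hb]
      | tmul p v => simp [extAct_tmul, TensorProduct.smul_tmul', mul_left_comm]
  have h2 : LinearMap.rTensor V (twistedField a D.1) (f • w) =
      D.1 f • w + f • LinearMap.rTensor V (twistedField a D.1) w := by
    clear h1
    induction w with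
    | zero => simp
    | add a b ha hb => simp only [smul_add, map_add, ha, hb]; abel
    | tmul p v =>
      simp only [TensorProduct.smul_tmul', LinearMap.rTensor_tmul, twistedField_apply,
        ← TensorProduct.add_tmul, Derivation.leibniz, smul_eq_mul]
      congr 1; ring
  simp only [tensorAct, LinearMap.add_apply, h1, h2, smul_add]
  abel

end tensor

/-- `A₂` as an abelian Lie algebra. -/
noncomputable instance (priority := 10) instLieRingA2 : LieRing A2 where
  bracket _ _ := 0
  add_lie _ _ _ := by simp
  lie_add _ _ _ := by simp
  lie_self _ := rfl
  leibniz_lie _ _ _ := by simp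

noncomputable instance (priority := 10) instLieAlgebraA2 : LieAlgebra ℂ A2 where
  lie_smul c _ _ := (smul_zero (A := A2) c).symm

lemma lie_A2 (f g : A2) : ⁅f, g⁆ = 0 := rfl

/-- `S̄₂` acts on `A₂` by derivations. -/
noncomputable def derivAction : Sbar →ₗ⁅ℂ⁆ LieDerivation ℂ A2 A2 where
  toFun D :=
    { toLinearMap := D.1.toLinearMap
      leibniz' := fun _ _ => by
        simp only [lie_A2, sub_self]; exact map_zero D.1 }
  map_add' _ _ := rfl
  map_smul' _ _ := rfl
  map_lie' := rfl

/-- The semidirect product `S̃₂ = S̄₂ ⋉ A₂`. -/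
abbrev Stilde : Type := LieAlgebra.SemiDirectSum A2 Sbar derivAction

/-- The inclusion of `A₂` in `S̃₂`. -/
noncomputable def inA : A2 →ₗ⁅ℂ⁆ Stilde := LieAlgebra.SemiDirectSum.inl derivAction
/-- The inclusion of `S̄₂` in `S̃₂`. -/
noncomputable def inS : Sbar →ₗ⁅ℂ⁆ Stilde := LieAlgebra.SemiDirectSum.inr derivAction

lemma inS_lie_inA (D : Sbar) (f : A2) : ⁅inS D, inA f⁆ = inA (D.1 f) := by
  refine LieAlgebra.SemiDirectSum.ext ?_ ?_
  · change (0 : A2) + D.1 f - derivAction 0 0 = D.1 f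
    simp
  · change ⁅D, (0 : Sbar)⁆ = 0
    simp

/-- Modules over a complex Lie algebra `L`; the morphisms are the `L`-module homomorphisms. -/
structure LieModCat (L : Type w) [LieRing L] [LieAlgebra ℂ L] where
  carrier : Type u
  [addCommGroup : AddCommGroup carrier]
  [module : Module ℂ carrier]
  [lieRingModule : LieRingModule L carrier]
  [lieModule : LieModule ℂ L carrier]

attribute [instance] LieModCat.addCommGroup LieModCat.module LieModCat.lieRingModule
  LieModCat.lieModule

instance (L : Type w) [LieRing L] [LieAlgebra ℂ L] : CoeSort (LieModCat.{w, u} L) (Type u) :=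
  ⟨LieModCat.carrier⟩

instance (L : Type w) [LieRing L] [LieAlgebra ℂ L] :
    Category (LieModCat.{w, u} L) where
  Hom M N := M →ₗ⁅ℂ, L⁆ N
  id _ := LieModuleHom.id
  comp f g := g.comp f

/-- The abelian subalgebra `Δ₂ = span {∂₁, ∂₂}` of `S̄₂`. -/
noncomputable def Delta : LieSubalgebra ℂ Sbar where
  toSubmodule := Submodule.span ℂ (Set.range partialS)
  lie_mem' := by
    intro x y hx hy
    change x ∈ Submodule.span ℂ (Set.range partialS) at hx
    change y ∈ Submodule.span ℂ (Set.range partialS) at hy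
    have : ⁅x, y⁆ = 0 := by
      induction hx, hy using Submodule.span_induction₂ with
      | mem_mem x y hx hy =>
        obtain ⟨i, rfl⟩ := hx
        obtain ⟨j, rfl⟩ := hy
        exact adPartial_partial i j
      | zero_left => simp
      | zero_right => simp
      | add_left x y z _ _ _ h1 h2 => rw [add_lie, h1, h2, add_zero]
      | add_right x y z _ _ _ h1 h2 => rw [lie_add, h1, h2, add_zero]
      | smul_left c x y _ _ h => rw [smul_lie, h, smul_zero]
      | smul_right c x y _ _ h => rw [lie_smul, h, smul_zero]
    change ⁅x, y⁆ ∈ Submodule.span ℂ (Set.range partialS)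
    rw [this]; exact zero_mem _

/-- The character `φ_a` of `Δ₂`, `φ_a(∂_i) = a_i`. (`Δ₂` is abelian, so every linear functional is a
Lie algebra homomorphism.) -/
noncomputable def phi (a : Fin 2 → ℂ) : Delta →ₗ[ℂ] ℂ :=
  (∑ i, a i • atOrigin i) ∘ₗ Delta.toSubmodule.subtype

lemma partialS_mem (i : Fin 2) : partialS i ∈ Delta := Submodule.subset_span ⟨i, rfl⟩

lemma phi_partialS (a : Fin 2 → ℂ) (i : Fin 2) : phi a ⟨partialS i, partialS_mem i⟩ = a i := by
  have h : ∀ j, atOrigin j (partialS i) = if i = j then 1 else 0 := by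
    intro j
    rw [atOrigin_apply]
    change coeff 0 (pderiv i (X j)) = _
    rw [pderiv_X, Pi.single_apply]
    split_ifs with h1 h2 h2
    · simp
    · exact absurd h1.symm h2
    · exact absurd h2.symm h1
    · simp
  change (∑ j, a j • atOrigin j) (partialS i) = a i
  simp only [LinearMap.sum_apply, LinearMap.smul_apply, h, smul_eq_mul, mul_ite, mul_one, mul_zero,
    Finset.sum_ite_eq, Finset.mem_univ, if_true]

section tensorModule
variable (a : Fin 2 → ℂ) (V : Type u) [AddCommGroup V] [Module ℂ V]
    [LieRingModule SbarGE V] [LieModule ℂ SbarGE V]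

/-- The `S̃₂`-module structure of `T(A₂^a, V)`: `A₂` acts by multiplication on the factor `A₂^a`, and
`S̄₂` by `tensorAct`. -/
@[reducible]
noncomputable def tensorLieRingModule : LieRingModule Stilde (A2 ⊗[ℂ] V) where
  bracket s w := s.left • w + tensorAct a V s.right w
  add_lie s t w := by
    change (s.left + t.left) • w + tensorAct a V (s.right + t.right) w = _
    rw [add_smul, tensorAct_add, LinearMap.add_apply]; abel
  lie_add s w w' := by
    rw [smul_add, map_add]; abel
  leibniz_lie s t w := by
    change _ = (((0 : A2) + s.right.1 t.left - t.right.1 s.left) • w +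
      tensorAct a V ⁅s.right, t.right⁆ w) + _
    simp only [map_add, smul_add, tensorAct_smul_A2, tensorAct_lie, zero_add]
    have hs : (s.right.1 t.left - t.right.1 s.left) • w
        = s.right.1 t.left • w - t.right.1 s.left • w :=
      sub_smul (R := A2) (M := A2 ⊗[ℂ] V) _ _ _
    rw [hs, smul_smul, smul_smul, mul_comm]
    abel

lemma tensorLieModule :
    letI := tensorLieRingModule a V
    LieModule ℂ Stilde (A2 ⊗[ℂ] V) :=
  letI := tensorLieRingModule a V
  { smul_lie := fun c s w => by
      change (c • s.left) • w + tensorAct a V (c • s.right) w =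
        c • (s.left • w + tensorAct a V s.right w)
      rw [tensorAct_smul, smul_assoc, smul_add, LinearMap.smul_apply]
    lie_smul := fun c s w => by
      change s.left • (c • w) + tensorAct a V s.right (c • w) =
        c • (s.left • w + tensorAct a V s.right w)
      rw [map_smul, smul_add, smul_comm] }

end tensorModule

/-- The `S̃₂`-module `T(A₂^a, V)`. -/
noncomputable def tensorObj (a : Fin 2 → ℂ) (V : LieModCat.{0, u} SbarGE) :
    LieModCat.{0, u} Stilde :=
  letI := tensorLieRingModule a V
  haveI := tensorLieModule a V
  { carrier := A2 ⊗[ℂ] V }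

lemma lTensor_tensorAct (a : Fin 2 → ℂ) {V W : LieModCat.{0, u} SbarGE} (f : V →ₗ⁅ℂ, SbarGE⁆ W)
    (D : Sbar) (w : A2 ⊗[ℂ] V) :
    LinearMap.lTensor A2 (f : V →ₗ[ℂ] W) (tensorAct a V D w) =
      tensorAct a W D (LinearMap.lTensor A2 (f : V →ₗ[ℂ] W) w) := by
  have h : ∀ z : A2 ⊗[ℂ] SbarGE, LinearMap.lTensor A2 (f : V →ₗ[ℂ] W) (extAct SbarGE V z w) =
      extAct SbarGE W z (LinearMap.lTensor A2 (f : V →ₗ[ℂ] W) w) := by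
    intro z
    induction z with
    | zero => simp
    | add a b ha hb => simp only [map_add, LinearMap.add_apply, ha, hb]
    | tmul g y =>
      induction w with
      | zero => simp
      | add a b ha hb => simp only [map_add, ha, hb]
      | tmul p v => simp [extAct_tmul]
  simp only [tensorAct, LinearMap.add_apply, map_add, h]
  congr 1
  rw [← LinearMap.comp_apply, ← LinearMap.comp_apply, LinearMap.lTensor_comp_rTensor,
    LinearMap.rTensor_comp_lTensor]

/-- `T(A₂^a, f) = id ⊗ f`. -/
noncomputable def tensorMap (a : Fin 2 → ℂ) {V W : LieModCat.{0, u} SbarGE}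
    (f : V →ₗ⁅ℂ, SbarGE⁆ W) : tensorObj a V →ₗ⁅ℂ, Stilde⁆ tensorObj a W where
  toLinearMap := LinearMap.lTensor A2 (f : V →ₗ[ℂ] W)
  map_lie' := by
    intro s (w : A2 ⊗[ℂ] V)
    change LinearMap.lTensor A2 (f : V →ₗ[ℂ] W) (s.left • w + tensorAct a V s.right w) =
      s.left • (LinearMap.lTensor A2 (f : V →ₗ[ℂ] W) w : A2 ⊗[ℂ] W) +
        tensorAct a W s.right (LinearMap.lTensor A2 (f : V →ₗ[ℂ] W) w)
    rw [map_add, lTensor_tensorAct]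
    congr 1
    exact (LinearMap.baseChange A2 (f : V →ₗ[ℂ] W)).map_smul s.left w

/-- The functor `V ↦ T(A₂^a, V)`. -/
noncomputable def tensorFunctor (a : Fin 2 → ℂ) :
    LieModCat.{0, u} SbarGE ⥤ LieModCat.{0, u} Stilde where
  obj V := tensorObj a V
  map f := tensorMap a f
  map_id V := LieModuleHom.ext fun w => LinearMap.congr_fun (LinearMap.lTensor_id A2 V) w
  map_comp f g := LieModuleHom.ext fun w =>
    LinearMap.congr_fun (LinearMap.lTensor_comp A2 (g : _ →ₗ⁅ℂ, SbarGE⁆ _).toLinearMap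
      (f : _ →ₗ⁅ℂ, SbarGE⁆ _).toLinearMap) w

lemma inS_inA {M : Type u} [AddCommGroup M] [LieRingModule Stilde M] (D : Sbar) (f : A2) (m : M) :
    ⁅inS D, ⁅inA f, m⁆⁆ = ⁅inA (D.1 f), m⁆ + ⁅inA f, ⁅inS D, m⁆⁆ := by
  rw [leibniz_lie, inS_lie_inA]

section whittaker
variable (M : Type u) [AddCommGroup M] [Module ℂ M] [LieRingModule Stilde M] [LieModule ℂ Stilde M]

/-- An `(A₂, S̄₂)`-module is an `S̃₂`-module on which `A₂` acts associatively. -/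
structure IsASModule : Prop where
  mul_act : ∀ (f g : A2) (m : M), ⁅inA f, ⁅inA g, m⁆⁆ = ⁅inA (f * g), m⁆
  one_act : ∀ m : M, ⁅inA 1, m⁆ = m

/-- A Whittaker module: `Δ₂` acts locally finitely, i.e. every vector lies in a finite-dimensional
`Δ₂`-stable subspace. -/
def IsWhittakerModule : Prop :=
  ∀ m : M, ∃ N : Submodule ℂ M, FiniteDimensional ℂ N ∧ m ∈ N ∧
    ∀ x : Delta, ∀ n ∈ N, ⁅inS x, n⁆ ∈ N

/-- `M = M(a)`: for all `m ∈ M` and `x ∈ Δ₂` some power of `x - φ_a(x)` kills `m`. -/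
def IsOfType (a : Fin 2 → ℂ) : Prop :=
  ∀ m : M, ∀ x : Delta, ∃ k : ℕ,
    ((LieModule.toEnd ℂ Stilde M (inS x) - phi a x • (1 : Module.End ℂ M)) ^ k) m = 0

/-- The space `Wh_a(M)` of Whittaker vectors. -/
def Wh (a : Fin 2 → ℂ) : Submodule ℂ M where
  carrier := {m | ∀ x : Delta, ⁅inS x, m⁆ = phi a x • m}
  zero_mem' := by intro x; simp
  add_mem' := by
    intro m n hm hn x
    rw [lie_add, hm x, hn x, smul_add]
  smul_mem' := by
    intro c m hm x
    rw [lie_smul, hm x, smul_comm]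

/-- `f ⊗ D ∈ A₂ ⊗ S̄₂` acts on an `S̃₂`-module by `m ↦ f (D m)`. -/
noncomputable def smashAct : A2 ⊗[ℂ] Sbar →ₗ[ℂ] Module.End ℂ M :=
  TensorProduct.lift ((LinearMap.mul ℂ (Module.End ℂ M)).compl₁₂
    ((LieModule.toEnd ℂ Stilde M : Stilde →ₗ[ℂ] Module.End ℂ M) ∘ₗ (inA : A2 →ₗ[ℂ] Stilde))
    ((LieModule.toEnd ℂ Stilde M : Stilde →ₗ[ℂ] Module.End ℂ M) ∘ₗ (inS : Sbar →ₗ[ℂ] Stilde)))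

/-- The operator `∑_r (-1)^{|r|} (t^r / r!) ∘ ∂^r D`. For `D ∈ S̄₂^{≥0}` this is the action of the
preimage of `1 ⊗ D` under the isomorphism `A₂ # U(S̄₂) ≅ 𝒟₂ ⊗ U(S̄₂^{≥0})`. -/
noncomputable def whAct (D : Sbar) : Module.End ℂ M := smashAct M (taylor (-1) D)

variable {M}

lemma smashAct_tmul (f : A2) (D : Sbar) (m : M) :
    smashAct M (f ⊗ₜ D) m = ⁅inA f, ⁅inS D, m⁆⁆ := rfl

lemma inS_smashAct (Z : Sbar) (z : A2 ⊗[ℂ] Sbar) (m : M) :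
    ⁅inS Z, smashAct M z m⁆ = smashAct M (LinearMap.rTensor Sbar Z.1.toLinearMap z) m +
      smashAct M (extAct Sbar Sbar (1 ⊗ₜ Z) z) m + smashAct M z ⁅inS Z, m⁆ := by
  induction z with
  | zero => simp
  | add a b ha hb => simp only [map_add, LinearMap.add_apply, lie_add, ha, hb]; abel
  | tmul f D =>
    simp only [extAct_tmul, LinearMap.rTensor_tmul, smashAct_tmul, one_mul, Derivation.coeFn_coe]
    rw [inS_inA, leibniz_lie (inS Z) (inS D), ← LieHom.map_lie, lie_add, add_assoc]

lemma whAct_commute_partial (D : Sbar) (i : Fin 2) (m : M) :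
    ⁅inS (partialS i), whAct M D m⁆ = whAct M D ⁅inS (partialS i), m⁆ := by
  rw [whAct, inS_smashAct, extAct_tmul_partial, one_smul]
  change smashAct M (LinearMap.rTensor Sbar (pderiv i : W2).toLinearMap (taylor (-1) D)) m + _ + _
    = _
  rw [pderiv_taylor]
  simp

lemma whAct_commute_Delta (D : Sbar) (x : Sbar) (hx : x ∈ Delta) (m : M) :
    ⁅inS x, whAct M D m⁆ = whAct M D ⁅inS x, m⁆ := by
  change x ∈ Submodule.span ℂ (Set.range partialS) at hx
  induction hx using Submodule.span_induction with
  | mem x hx => obtain ⟨i, rfl⟩ := hx; exact whAct_commute_partial D i m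
  | zero => rw [map_zero, zero_lie, zero_lie, map_zero]
  | add x y _ _ h1 h2 => simp only [map_add, add_lie, h1, h2]
  | smul c x _ h => simp only [map_smul, smul_lie, h]

lemma whAct_mem (a : Fin 2 → ℂ) (D : Sbar) {m : M} (hm : m ∈ Wh M a) : whAct M D m ∈ Wh M a := by
  intro x
  rw [whAct_commute_Delta D x x.2, hm x, map_smul]

/-- `f ⊗ D ↦ f p_j` for `D = ∑ j, p_j ∂_j`. -/
noncomputable def evalComp (j : Fin 2) : A2 ⊗[ℂ] Sbar →ₗ[ℂ] A2 :=
  TensorProduct.lift ((LinearMap.mul ℂ A2).compl₂ (component j))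

lemma evalComp_tmul (j : Fin 2) (f : A2) (D : Sbar) : evalComp j (f ⊗ₜ D) = f * D.1 (X j) := rfl

lemma evalComp_taylor (j : Fin 2) {D : Sbar} (hD : D ∈ SbarGE) :
    evalComp j (taylor (-1) D) = 0 := by
  have h1 : ∀ (i : Fin 2) (z : A2 ⊗[ℂ] Sbar), pderiv i (evalComp j z) =
      evalComp j (LinearMap.rTensor Sbar (pderiv i : W2).toLinearMap z) +
      evalComp j (LinearMap.lTensor A2 (adPartial i) z) := by
    intro i z
    induction z with
    | zero => simp
    | add a b ha hb => simp only [map_add, ha, hb]; abel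
    | tmul f E =>
      simp only [LinearMap.rTensor_tmul, LinearMap.lTensor_tmul, evalComp_tmul, pderiv_mul]
      have := component_adPartial i j E
      simp only [component, LinearMap.coe_mk, AddHom.coe_mk] at this
      rw [this]; rfl
  have h2 : ∀ z : A2 ⊗[ℂ] Sbar, coeff 0 (evalComp j z) = atOrigin j (tcoeff 0 z) := by
    intro z
    induction z with
    | zero => simp
    | add a b ha hb => simp only [map_add, coeff_add, ha, hb]
    | tmul f E =>
      simp only [evalComp_tmul, tcoeff_tmul, map_smul, atOrigin_apply, ← constantCoeff_eq, map_mul,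
        smul_eq_mul]
  have h3 : ∀ i, pderiv i (evalComp j (taylor (-1) D)) = 0 := by
    intro i
    rw [h1, pderiv_taylor]; simp
  ext r
  rw [coeff_zero]
  induction r using multi_induction with
  | h0 => rw [h2, tcoeff_zero_taylor, atOrigin_of_mem hD]
  | hs r i _ =>
    have := congrArg (coeff r) (h3 i)
    rw [coeff_pderiv, coeff_zero] at this
    exact (mul_eq_zero.mp this).resolve_right (Nat.cast_add_one_ne_zero _)

lemma whAct_commute_A2 (hM : IsASModule M) {D : Sbar} (hD : D ∈ SbarGE) (g : A2) (m : M) :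
    whAct M D ⁅inA g, m⁆ = ⁅inA g, whAct M D m⁆ := by
  have h : ∀ z : A2 ⊗[ℂ] Sbar, smashAct M z ⁅inA g, m⁆ =
      ⁅inA (∑ i, evalComp i z * pderiv i g), m⁆ + ⁅inA g, smashAct M z m⁆ := by
    intro z
    induction z with
    | zero =>
      simp only [map_zero, zero_mul, Finset.sum_const_zero, LinearMap.zero_apply, lie_zero,
        zero_lie, add_zero]
    | add a b ha hb =>
      simp only [map_add, LinearMap.add_apply, lie_add, ha, hb, add_mul, Finset.sum_add_distrib,
        add_lie]
      abel
    | tmul f E =>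
      simp only [smashAct_tmul, evalComp_tmul, mul_assoc, ← Finset.mul_sum, ← W2_apply]
      rw [inS_inA, lie_add, hM.mul_act, hM.mul_act, hM.mul_act, mul_comm g f]
  rw [whAct, h]
  simp only [evalComp_taylor _ hD, zero_mul, Finset.sum_const_zero, map_zero, zero_lie, zero_add]

lemma inA_smashAct (hM : IsASModule M) (g : A2) (z : A2 ⊗[ℂ] Sbar) (m : M) :
    ⁅inA g, smashAct M z m⁆ = smashAct M (g • z) m := by
  induction z with
  | zero => simp
  | add a b ha hb => simp only [map_add, LinearMap.add_apply, lie_add, ha, hb, smul_add]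
  | tmul f E => rw [TensorProduct.smul_tmul', smashAct_tmul, smashAct_tmul, hM.mul_act, smul_eq_mul]

lemma whAct_lie (hM : IsASModule M) {D E : Sbar} (hD : D ∈ SbarGE) (hE : E ∈ SbarGE) (m : M) :
    whAct M ⁅D, E⁆ m = whAct M D (whAct M E m) - whAct M E (whAct M D m) := by
  have h : ∀ w : A2 ⊗[ℂ] Sbar, whAct M D (smashAct M w m) =
      smashAct M w (whAct M D m) -
      smashAct M (∑ i, evalComp i w •
        LinearMap.rTensor Sbar (pderiv i : W2).toLinearMap (taylor (-1) D)) m -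
      smashAct M (extAct Sbar Sbar w (taylor (-1) D)) m := by
    intro w
    induction w with
    | zero => simp
    | add a b ha hb =>
      simp only [map_add, LinearMap.add_apply, ha, hb, add_smul, Finset.sum_add_distrib]
      abel
    | tmul g Z =>
      rw [smashAct_tmul, whAct_commute_A2 hM hD, smashAct_tmul]
      have h1 := inS_smashAct Z (taylor (-1) D) m
      have h2 : extAct Sbar Sbar (g ⊗ₜ Z) (taylor (-1) D)
          = g • extAct Sbar Sbar (1 ⊗ₜ Z) (taylor (-1) D) := by
        induction taylor (-1) D with
        | zero => simp
        | add a b ha hb => simp only [map_add, smul_add, ha, hb]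
        | tmul p v => simp [extAct_tmul, TensorProduct.smul_tmul']
      have h3 : (∑ i, evalComp i (g ⊗ₜ Z) •
          LinearMap.rTensor Sbar (pderiv i : W2).toLinearMap (taylor (-1) D))
          = g • LinearMap.rTensor Sbar Z.1.toLinearMap (taylor (-1) D) := by
        rw [rTensor_eq_sum Z.1, Finset.smul_sum]
        simp only [evalComp_tmul, mul_smul]
      rw [h2, h3, ← inA_smashAct hM, ← inA_smashAct hM]
      change ⁅inA g, smashAct M (taylor (-1) D) ⁅inS Z, m⁆⁆ =
        ⁅inA g, ⁅inS Z, smashAct M (taylor (-1) D) m⁆⁆ - _ - _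
      rw [h1, lie_add, lie_add]
      abel
  have h' := h (taylor (-1) E)
  rw [extAct_skew, ← taylor_lie] at h'
  simp only [evalComp_taylor _ hE, zero_smul, Finset.sum_const_zero, map_zero,
    LinearMap.zero_apply, sub_zero, map_neg, LinearMap.neg_apply, sub_neg_eq_add] at h'
  change whAct M D (whAct M E m) = whAct M E (whAct M D m) + whAct M ⁅D, E⁆ m at h'
  rw [h']; abel

lemma whAct_add (D E : Sbar) (m : M) : whAct M (D + E) m = whAct M D m + whAct M E m := by
  change smashAct M (taylorₗ (-1) (D + E)) m = _
  rw [map_add, map_add]; rfl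

lemma whAct_smul (c : ℂ) (D : Sbar) (m : M) : whAct M (c • D) m = c • whAct M D m := by
  change smashAct M (taylorₗ (-1) (c • D)) m = _
  rw [map_smul, map_smul]; rfl

variable (M) in
/-- The `S̄₂^{≥0}`-module structure of `Wh_a(M)`, given by `whAct`. -/
@[reducible]
noncomputable def whLieRingModule (a : Fin 2 → ℂ) (hM : IsASModule M) :
    LieRingModule SbarGE (Wh M a) where
  bracket x m := ⟨whAct M x m, whAct_mem a x m.2⟩
  add_lie x y m := Subtype.ext (whAct_add x.1 y.1 m.1)
  lie_add x m n := Subtype.ext (map_add (whAct M x.1) m.1 n.1)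
  leibniz_lie x y m := Subtype.ext (by
    have h := whAct_lie hM x.2 y.2 m.1
    change whAct M x.1 (whAct M y.1 m.1) =
      whAct M ⁅x.1, y.1⁆ m.1 + whAct M y.1 (whAct M x.1 m.1)
    rw [h]; abel)

variable (M) in
lemma whLieModule (a : Fin 2 → ℂ) (hM : IsASModule M) :
    letI := whLieRingModule M a hM
    LieModule ℂ SbarGE (Wh M a) :=
  letI := whLieRingModule M a hM
  { smul_lie := fun c x m => Subtype.ext (whAct_smul c x.1 m.1)
    lie_smul := fun c x m => Subtype.ext (map_smul (whAct M x.1) c m.1) }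

end whittaker

/-- The conditions that define the block: Whittaker `(A₂, S̄₂)`-modules of type `φ_a` with
finite-dimensional space of Whittaker vectors. -/
structure IsOmega (a : Fin 2 → ℂ) (M : LieModCat.{0, u} Stilde) : Prop where
  isAS : IsASModule M
  isWhittaker : IsWhittakerModule M
  isOfType : IsOfType M a
  finite : FiniteDimensional ℂ (Wh M a)

/-- The conditions of `IsOmega` as a property of objects. -/
def isOmega (a : Fin 2 → ℂ) : ObjectProperty (LieModCat.{0, u} Stilde) := IsOmega a

/-- The category `Ω_a`, a full subcategory of the category of `S̃₂`-modules. -/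
abbrev Omega (a : Fin 2 → ℂ) := (isOmega.{u} a).FullSubcategory

/-- Finite-dimensional `S̄₂^{≥0}`-modules. -/
def isFiniteDimensional : ObjectProperty (LieModCat.{0, u} SbarGE) := fun V => FiniteDimensional ℂ V

/-- The category of finite-dimensional `S̄₂^{≥0}`-modules. -/
abbrev SbarGEFMod := isFiniteDimensional.{u}.FullSubcategory

/-- `Wh_a(M)` as an `S̄₂^{≥0}`-module. -/
noncomputable def whObj (a : Fin 2 → ℂ) (M : Omega.{u} a) : SbarGEFMod.{u} where
  obj :=
    letI := whLieRingModule M.obj a M.property.isAS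
    haveI := whLieModule M.obj a M.property.isAS
    { carrier := Wh M.obj a }
  property := M.property.finite

lemma map_smashAct {M N : LieModCat.{0, u} Stilde} (f : M →ₗ⁅ℂ, Stilde⁆ N) (z : A2 ⊗[ℂ] Sbar)
    (m : M) : f (smashAct M z m) = smashAct N z (f m) := by
  induction z with
  | zero => simp
  | add a b ha hb => simp only [map_add, LinearMap.add_apply, ha, hb]
  | tmul g Z => simp only [smashAct_tmul, LieModuleHom.map_lie]

/-- The restriction of a homomorphism `M → N` to Whittaker vectors. -/
noncomputable def whMap (a : Fin 2 → ℂ) {M N : Omega.{u} a} (f : M.obj →ₗ⁅ℂ, Stilde⁆ N.obj) :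
    (whObj a M).obj →ₗ⁅ℂ, SbarGE⁆ (whObj a N).obj where
  toLinearMap := LinearMap.restrict (p := Wh M.obj a) (q := Wh N.obj a) f.toLinearMap
    (fun m hm x => by
      change ⁅inS x.1, f m⁆ = phi a x • f m
      rw [← LieModuleHom.map_lie, hm x, map_smul])
  map_lie' {x m} := Subtype.ext (map_smashAct f _ m.1)

/-- The functor `M ↦ Wh_a(M)`. -/
noncomputable def whittakerFunctor (a : Fin 2 → ℂ) : Omega.{u} a ⥤ SbarGEFMod.{u} where
  obj M := whObj a M
  map f := ObjectProperty.homMk (whMap a f.hom)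
  map_id _ := rfl
  map_comp _ _ := rfl

end WhittakerS2

/-! Two facts carry the theorem: a Kashiwara-type lemma for the Weyl algebra, and a Taylor inversion
that separates the Weyl algebra from `SbarGE` inside the algebra generated by `A2` and `Sbar`.

On an $(A_2,\bar S_2)$-module $M$ the operators $\theta_i=\partial_i-a_i$ and $t_i$ satisfy the Weyl
relations. If both $\theta_i$ are locally nilpotent, then $M$ is freely generated over $A_2$ by the
common kernel of the $\theta_i$, which is $\mathrm{Wh}_{\mathbf a}(M)$. Hence $p\otimes v\mapsto pv$
is a bijection $A_2\otimes\mathrm{Wh}_{\mathbf a}(M)\to M$ (`mulMap_injective`,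
`mulMap_surjective`).

To see that this bijection respects $\bar S_2$, put
$\omega(D)=\sum_r(-1)^{|r|}\frac{t^r}{r!}\partial^rD$. Taylor expansion with the opposite sign
inverts this: $D=\sum_r\frac{t^r}{r!}\omega(\partial^rD)$ (`taylorInv_taylor`). Split each
$\partial^rD$ into its part in $\bar S_2^{\ge0}$ and its constant part. The first parts give the sum
over $r$ in the action on $T(A_2^{\mathbf a},V)$; the constant parts add up to
$\sum_ip_i\partial_i$, which acts on Whittaker vectors as $\sum_ia_ip_i$ (`mulMap_tensorAct`).

Conversely, $\theta_i$ acts on $T(A_2^{\mathbf a},V)$ by differentiating the polynomial factor. It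
therefore lowers the degree, so $T(A_2^{\mathbf a},V)$ is a Whittaker module of the right type, and
its Whittaker vectors are the constants $1\otimes V$. A Whittaker vector is thus determined by its
constant coefficient, and comparing constant coefficients shows that $\omega(D)$ acts on $1\otimes
V$ as $D$ acts on $V$ (`whAct_one_tmul`). -/

namespace WhittakerS2

open MvPolynomial TensorProduct CategoryTheory

/-! ### Coefficients and degree in $A_2\otimes V=V[t_1,t_2]$ -/

section degree
variable {V : Type*} [AddCommGroup V] [Module ℂ V]

lemma tcoeff_zero_smul (f : A2) (w : A2 ⊗[ℂ] V) :
    tcoeff 0 (f • w) = coeff 0 f • tcoeff 0 w := by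
  induction w with
  | zero => simp
  | add a b ha hb => simp only [smul_add, map_add, ha, hb]
  | tmul g v =>
    simp only [TensorProduct.smul_tmul', tcoeff_tmul, smul_eq_mul, smul_smul, ← constantCoeff_eq,
      map_mul]

/-- In characteristic 0 the coefficient of $t^{r+e_i}$ is recovered from the coefficient of $t^r$ in
the $i$-th derivative, so only the constant coefficient can survive. -/
lemma eq_one_tmul_of_pderiv_eq_zero {w : A2 ⊗[ℂ] V}
    (h : ∀ i, LinearMap.rTensor V (pderiv i : W2).toLinearMap w = 0) :
    w = 1 ⊗ₜ[ℂ] tcoeff 0 w := by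
  refine tcoeff_ext fun r => ?_
  induction r using multi_induction with
  | h0 => rw [tcoeff_tmul]; simp
  | hs r i _ =>
    have h1 := congrArg (tcoeff r) (h i)
    rw [tcoeff_pderiv, map_zero] at h1
    rw [(smul_eq_zero.mp h1).resolve_left (Nat.cast_add_one_ne_zero _), tcoeff_tmul, coeff_one,
      if_neg, zero_smul]
    intro h2
    have := DFunLike.congr_fun h2 i
    simp at this

variable (V) in
/-- The elements of degree less than `n` of `A₂ ⊗ V = V[t₁, t₂]`. -/
noncomputable def degreeLT (n : ℕ) : Submodule ℂ (A2 ⊗[ℂ] V) :=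
  ⨅ r : {r : Fin 2 →₀ ℕ // n ≤ r.degree}, LinearMap.ker (tcoeff (L := V) r.1)

lemma mem_degreeLT {n : ℕ} {w : A2 ⊗[ℂ] V} :
    w ∈ degreeLT V n ↔ ∀ r : Fin 2 →₀ ℕ, n ≤ r.degree → tcoeff r w = 0 := by
  simp [degreeLT]

lemma degreeLT_mono {m n : ℕ} (h : m ≤ n) : degreeLT V m ≤ degreeLT V n :=
  fun _ hw => mem_degreeLT.2 fun r hr => mem_degreeLT.1 hw r (h.trans hr)

lemma eq_zero_of_mem_degreeLT_zero {w : A2 ⊗[ℂ] V} (h : w ∈ degreeLT V 0) : w = 0 :=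
  tcoeff_ext fun r => by rw [mem_degreeLT.1 h r (Nat.zero_le _), map_zero]

lemma exists_mem_degreeLT (w : A2 ⊗[ℂ] V) : ∃ n, w ∈ degreeLT V n := by
  induction w with
  | zero => exact ⟨0, zero_mem _⟩
  | add a b ha hb =>
    obtain ⟨m, hm⟩ := ha
    obtain ⟨n, hn⟩ := hb
    exact ⟨max m n, add_mem (degreeLT_mono (le_max_left _ _) hm)
      (degreeLT_mono (le_max_right _ _) hn)⟩
  | tmul f v =>
    refine ⟨f.totalDegree + 1, mem_degreeLT.2 fun r hr => ?_⟩
    rw [tcoeff_tmul, coeff_eq_zero_of_totalDegree_lt, zero_smul]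
    exact hr

lemma pderiv_mem_degreeLT {n : ℕ} {w : A2 ⊗[ℂ] V} (h : w ∈ degreeLT V (n + 1)) (i : Fin 2) :
    LinearMap.rTensor V (pderiv i : W2).toLinearMap w ∈ degreeLT V n := by
  refine mem_degreeLT.2 fun r hr => ?_
  rw [tcoeff_pderiv, mem_degreeLT.1 h, smul_zero]
  simpa [map_add, Finsupp.degree_single] using hr

lemma finiteDimensional_degreeLT [FiniteDimensional ℂ V] (n : ℕ) :
    FiniteDimensional ℂ (degreeLT V n) := by
  have hfin : {r : Fin 2 →₀ ℕ | r.degree < n}.Finite := by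
    refine (Set.finite_Iic (Finsupp.single 0 n + Finsupp.single 1 n)).subset fun r hr => ?_
    rw [Set.mem_Iic, Finsupp.le_def]
    intro i
    have h1 : r i ≤ n := (Finsupp.le_degree i r).trans (le_of_lt hr)
    fin_cases i <;> simpa using h1
  have : Finite {r : Fin 2 →₀ ℕ // r.degree < n} := hfin.to_subtype
  -- The finitely many coefficients of degree below $n$ determine the element, which embeds the
  -- space in a finite power of $V$.
  let g : degreeLT V n →ₗ[ℂ] ({r : Fin 2 →₀ ℕ // r.degree < n} → V) :=
    LinearMap.pi fun r => tcoeff r.1 ∘ₗ (degreeLT V n).subtype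
  refine FiniteDimensional.of_injective g fun w w' h => Subtype.ext (tcoeff_ext fun r => ?_)
  by_cases hr : r.degree < n
  · exact congrFun h ⟨r, hr⟩
  · rw [mem_degreeLT.1 w.2 r (not_lt.1 hr), mem_degreeLT.1 w'.2 r (not_lt.1 hr)]

end degree

/-! ### The constant fields $\partial_i$ and their action on $A_2\otimes V$ -/

section tensorModuleProps
variable (a : Fin 2 → ℂ) {V : Type*} [AddCommGroup V] [Module ℂ V]
    [LieRingModule SbarGE V] [LieModule ℂ SbarGE V]

lemma projGE_partialS (i : Fin 2) : projGE (partialS i) = 0 := by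
  refine Subtype.ext ?_
  rw [projGE_coe]
  have h : ∀ j, atOrigin j (partialS i) = if i = j then 1 else 0 := by
    intro j
    -- For $\mathbf a=e_j$ the character $\phi_{\mathbf a}$ is the $j$-th coefficient at the origin.
    have h1 := phi_partialS (Pi.single j 1) i
    simp only [phi, LinearMap.comp_apply] at h1
    change (∑ k, (Pi.single j (1 : ℂ) : Fin 2 → ℂ) k • atOrigin k) (partialS i) = _ at h1
    rw [Pi.single_apply] at h1
    rw [← h1, LinearMap.sum_apply, Finset.sum_eq_single j]
    · simp
    · intro k _ hk; simp [hk]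
    · simp
  simp [h]

lemma lTensor_adPartial_taylor (c : ℂ) (i : Fin 2) (D : Sbar) :
    LinearMap.lTensor A2 (adPartial i) (taylor c D) = taylor c (adPartial i D) := by
  refine tcoeff_ext fun r => ?_
  have h : Commute (adPartial i) (iterAd r) :=
    Commute.mul_right ((adPartial_comm i 0).pow_right _) ((adPartial_comm i 1).pow_right _)
  rw [tcoeff_lTensor, tcoeff_taylor, tcoeff_taylor, map_smul, ← Module.End.mul_apply, h.eq,
    Module.End.mul_apply]

/-- All brackets of the $\partial_j$ vanish, so both sides solve the same differential equation with
the same constant coefficient. -/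
lemma taylor_partialS (c : ℂ) (i : Fin 2) : taylor c (partialS i) = 1 ⊗ₜ partialS i := by
  rw [← sub_eq_zero]
  refine taylor_unique c _ (by rw [map_sub, tcoeff_zero_taylor, tcoeff_tmul]; simp) fun j => ?_
  have h1 : LinearMap.lTensor A2 (adPartial j) (taylor c (partialS i)) = 0 := by
    rw [lTensor_adPartial_taylor, adPartial_partial]
    exact map_zero (taylorₗ c)
  simp only [map_sub, pderiv_taylor, h1, LinearMap.rTensor_tmul, LinearMap.lTensor_tmul,
    adPartial_partial, Derivation.coeFn_coe, Derivation.map_one_eq_zero, TensorProduct.zero_tmul,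
    TensorProduct.tmul_zero, smul_zero, sub_zero]

/-- A constant field has no part in $\bar S_2^{\ge0}$, so its cocycle vanishes and only the twisted
derivative remains. -/
lemma tensorAct_partialS (i : Fin 2) (w : A2 ⊗[ℂ] V) :
    tensorAct a V (partialS i) w =
      LinearMap.rTensor V (pderiv i : W2).toLinearMap w + a i • w := by
  have h : cocycle (partialS i) = 0 := by
    rw [cocycle_apply, taylor_partialS, LinearMap.lTensor_tmul, projGE_partialS,
      TensorProduct.tmul_zero]
  have h2 : twistedField a (partialS i).1 = (pderiv i : W2).toLinearMap + a i • LinearMap.id := by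
    refine LinearMap.ext fun p => ?_
    rw [twistedField_apply]
    change pderiv i p + (∑ j, a j • pderiv i (X j)) * p = pderiv i p + a i • p
    simp only [pderiv_X, Pi.single_apply]
    congr 1
    rw [Finset.sum_eq_single i]
    · simp
    · intro j _ hj; simp [hj]
    · simp
  rw [tensorAct, h, h2, map_zero, add_zero, LinearMap.rTensor_add, LinearMap.rTensor_smul,
    LinearMap.rTensor_id]
  rfl

lemma tcoeff_zero_extAct {L W : Type*} [LieRing L] [LieAlgebra ℂ L] [AddCommGroup W] [Module ℂ W]
    [LieRingModule L W] [LieModule ℂ L W] (z : A2 ⊗[ℂ] L) (w : W) :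
    tcoeff 0 (extAct L W z (1 ⊗ₜ w)) = ⁅tcoeff 0 z, w⁆ := by
  induction z with
  | zero => simp
  | add y z hy hz => simp only [map_add, LinearMap.add_apply, add_lie, hy, hz]
  | tmul f x => rw [extAct_tmul, tcoeff_tmul, tcoeff_tmul, mul_one, smul_lie]

/-- The projection `projGE` kills $\Delta_2$, and it subtracts exactly the constant part. -/
lemma Delta_eq_sum (x : Delta) : (x : Sbar) = ∑ i, atOrigin i x.1 • partialS i := by
  obtain ⟨x, hx⟩ := x
  change x ∈ Submodule.span ℂ (Set.range partialS) at hx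
  have h : ∀ x ∈ Submodule.span ℂ (Set.range partialS), projGE x = 0 := by
    intro x hx
    induction hx using Submodule.span_induction with
    | mem x hx => obtain ⟨i, rfl⟩ := hx; exact projGE_partialS i
    | zero => exact map_zero _
    | add x y _ _ h1 h2 => rw [map_add, h1, h2, add_zero]
    | smul c x _ h => rw [map_smul, h, smul_zero]
  have h1 := congrArg Subtype.val (h x hx)
  rw [projGE_coe] at h1
  exact sub_eq_zero.1 h1

lemma phi_eq_sum (x : Delta) : phi a x = ∑ i, a i * atOrigin i x.1 := by
  change (∑ i, a i • atOrigin i) x.1 = _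
  simp

end tensorModuleProps

/-! ### Reduction of conditions on $\Delta_2$ to $\partial_1$ and $\partial_2$ -/

section Delta
variable {M : Type u} [AddCommGroup M] [Module ℂ M] [LieRingModule Stilde M] [LieModule ℂ Stilde M]

lemma Delta_lie_eq_sum (x : Delta) (m : M) :
    ⁅inS x.1, m⁆ = ∑ i, atOrigin i x.1 • ⁅inS (partialS i), m⁆ := by
  conv_lhs => rw [Delta_eq_sum x]
  simp only [map_sum, map_smul, sum_lie, smul_lie]

lemma Delta_lie_sub (a : Fin 2 → ℂ) (x : Delta) (m : M) :
    ⁅inS x.1, m⁆ - phi a x • m =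
      ∑ i, atOrigin i x.1 • (⁅inS (partialS i), m⁆ - a i • m) := by
  rw [Delta_lie_eq_sum, phi_eq_sum, Finset.sum_smul, ← Finset.sum_sub_distrib]
  refine Finset.sum_congr rfl fun i _ => ?_
  rw [smul_sub, smul_smul, mul_comm]

lemma mem_Wh_iff {a : Fin 2 → ℂ} {m : M} :
    m ∈ Wh M a ↔ ∀ i, ⁅inS (partialS i), m⁆ = a i • m := by
  constructor
  · intro h i
    rw [← phi_partialS a i]
    exact h ⟨partialS i, partialS_mem i⟩
  · intro h x
    rw [← sub_eq_zero, Delta_lie_sub]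
    simp [h]

end Delta

/-! ### The module $T(A_2^{\mathbf a},V)$ and its Whittaker vectors -/

section tensorObj
variable (a : Fin 2 → ℂ) (V : LieModCat.{0, u} SbarGE)

/-- The identification of the underlying space of `T(A₂^a, V)` with `A₂ ⊗ V`. -/
noncomputable def tensorEquiv : A2 ⊗[ℂ] V ≃ₗ[ℂ] tensorObj a V := LinearEquiv.refl ℂ (A2 ⊗[ℂ] V)

lemma inA_tensorEquiv (f : A2) (w : A2 ⊗[ℂ] V) :
    ⁅inA f, tensorEquiv a V w⁆ = tensorEquiv a V (f • w) := by
  change f • w + tensorAct a V 0 w = f • w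
  have h : tensorAct a V (0 : Sbar) = 0 := by simpa using tensorAct_smul (V := V) a 0 0
  rw [h, LinearMap.zero_apply, add_zero]

lemma inS_tensorEquiv (D : Sbar) (w : A2 ⊗[ℂ] V) :
    ⁅inS D, tensorEquiv a V w⁆ = tensorEquiv a V (tensorAct a V D w) := by
  change (0 : A2) • w + tensorAct a V D w = _
  rw [zero_smul, zero_add]
  rfl

lemma partialS_tensorEquiv_sub (i : Fin 2) (w : A2 ⊗[ℂ] V) :
    ⁅inS (partialS i), tensorEquiv a V w⁆ - a i • tensorEquiv a V w =
      tensorEquiv a V (LinearMap.rTensor V (pderiv i : W2).toLinearMap w) := by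
  rw [inS_tensorEquiv, tensorAct_partialS, map_add, map_smul, add_sub_cancel_right]

/-- Here $x-\phi_{\mathbf a}(x)$ is a derivation in the polynomial variables with constant
coefficients. The resulting drop in degree yields both local finiteness and local nilpotency. -/
lemma exists_Delta_tensorEquiv_sub {n : ℕ} {w : A2 ⊗[ℂ] V} (h : w ∈ degreeLT V (n + 1))
    (x : Delta) : ∃ w' ∈ degreeLT V n,
      ⁅inS x.1, tensorEquiv a V w⁆ - phi a x • tensorEquiv a V w = tensorEquiv a V w' := by
  refine ⟨∑ i, atOrigin i x.1 • LinearMap.rTensor V (pderiv i : W2).toLinearMap w,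
    sum_mem fun i _ => Submodule.smul_mem _ _ (pderiv_mem_degreeLT h i), ?_⟩
  simp only [Delta_lie_sub, partialS_tensorEquiv_sub, map_sum, map_smul]

lemma isASModule_tensorObj : IsASModule (tensorObj a V) where
  mul_act f g m := by
    obtain ⟨w, rfl⟩ := (tensorEquiv a V).surjective m
    rw [inA_tensorEquiv, inA_tensorEquiv, inA_tensorEquiv, smul_smul]
  one_act m := by
    obtain ⟨w, rfl⟩ := (tensorEquiv a V).surjective m
    rw [inA_tensorEquiv, one_smul]

lemma isWhittakerModule_tensorObj [FiniteDimensional ℂ V] :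
    IsWhittakerModule (tensorObj a V) := by
  intro m
  obtain ⟨w, rfl⟩ := (tensorEquiv a V).surjective m
  obtain ⟨n, hn⟩ := exists_mem_degreeLT w
  have := finiteDimensional_degreeLT (V := V) n
  refine ⟨(degreeLT V n).map (tensorEquiv a V).toLinearMap, inferInstance, ⟨w, hn, rfl⟩, ?_⟩
  rintro x _ ⟨w, hw, rfl⟩
  -- Weakening the bound to $n+1$ before the drop keeps $w'$ in the same space, and it also covers
  -- $n=0$.
  obtain ⟨w', hw', h⟩ := exists_Delta_tensorEquiv_sub a V (degreeLT_mono n.le_succ hw) x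
  refine ⟨w' + phi a x • w, add_mem hw' (Submodule.smul_mem _ _ hw), ?_⟩
  simp only [LinearEquiv.coe_coe]
  rw [map_add, map_smul, ← h, sub_add_cancel]

lemma isOfType_tensorObj : IsOfType (tensorObj a V) a := by
  intro m x
  obtain ⟨w, rfl⟩ := (tensorEquiv a V).surjective m
  obtain ⟨n, hn⟩ := exists_mem_degreeLT w
  -- The bound on the degree serves as the exponent, since each application lowers it by one.
  refine ⟨n, ?_⟩
  induction n generalizing w with
  | zero => rw [eq_zero_of_mem_degreeLT_zero hn, map_zero, map_zero]
  | succ n ih =>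
    obtain ⟨w', hw', h⟩ := exists_Delta_tensorEquiv_sub a V hn x
    rw [pow_succ, Module.End.mul_apply]
    refine Eq.trans (congrArg _ ?_) (ih w' hw')
    exact h

lemma tensorEquiv_mem_Wh_iff {w : A2 ⊗[ℂ] V} :
    tensorEquiv a V w ∈ Wh (tensorObj a V) a ↔ w = 1 ⊗ₜ[ℂ] tcoeff 0 w := by
  rw [mem_Wh_iff]
  have h : ∀ i, ⁅inS (partialS i), tensorEquiv a V w⁆ = a i • tensorEquiv a V w ↔
      LinearMap.rTensor V (pderiv i : W2).toLinearMap w = 0 := by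
    intro i
    rw [← sub_eq_zero, partialS_tensorEquiv_sub, map_eq_zero_iff _ (tensorEquiv a V).injective]
  simp only [h]
  refine ⟨eq_one_tmul_of_pderiv_eq_zero, fun h i => ?_⟩
  rw [h, LinearMap.rTensor_tmul]
  simp

lemma one_tmul_mem_Wh (v : V) : tensorEquiv a V (1 ⊗ₜ v) ∈ Wh (tensorObj a V) a := by
  rw [tensorEquiv_mem_Wh_iff, tcoeff_tmul]
  simp

/-- The map `v ↦ 1 ⊗ v` from `V` to the Whittaker vectors of `T(A₂^a, V)`. -/
noncomputable def toWh : V →ₗ[ℂ] Wh (tensorObj a V) a :=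
  LinearMap.codRestrict (Wh (tensorObj a V) a)
    ((tensorEquiv a V).toLinearMap ∘ₗ TensorProduct.mk ℂ A2 V 1) (one_tmul_mem_Wh a V)

lemma toWh_bijective : Function.Bijective (toWh a V) := by
  constructor
  · intro v v' h
    have h1 : (1 : A2) ⊗ₜ[ℂ] v = (1 : A2) ⊗ₜ[ℂ] v' :=
      (tensorEquiv a V).injective (congrArg Subtype.val h)
    have h2 := congrArg (tcoeff 0) h1
    rw [tcoeff_tmul, tcoeff_tmul] at h2
    simpa using h2
  · rintro ⟨m, hm⟩
    obtain ⟨w, rfl⟩ := (tensorEquiv a V).surjective m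
    exact ⟨tcoeff 0 w, Subtype.ext (congrArg (tensorEquiv a V) ((tensorEquiv_mem_Wh_iff a V).1 hm).symm)⟩

lemma isOmega_tensorObj [FiniteDimensional ℂ V] : IsOmega a (tensorObj a V) where
  isAS := isASModule_tensorObj a V
  isWhittaker := isWhittakerModule_tensorObj a V
  isOfType := isOfType_tensorObj a V
  finite := Module.Finite.of_surjective (toWh a V) (toWh_bijective a V).2

/-- Multiplication by $f$ scales the constant coefficient by $f(0)$, so only the constant
coefficient of $z$ contributes. -/
lemma tcoeff_zero_smashAct (z : A2 ⊗[ℂ] Sbar) (w : A2 ⊗[ℂ] V) :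
    tcoeff 0 ((tensorEquiv a V).symm (smashAct (tensorObj a V) z (tensorEquiv a V w))) =
      tcoeff 0 (tensorAct a V (tcoeff 0 z) w) := by
  induction z with
  | zero =>
    have h : tensorAct a V (0 : Sbar) = 0 := by simpa using tensorAct_smul (V := V) a 0 0
    simp [h]
  | add y z hy hz => simp only [map_add, LinearMap.add_apply, tensorAct_add, hy, hz]
  | tmul f D =>
    rw [smashAct_tmul, inS_tensorEquiv, inA_tensorEquiv, LinearEquiv.symm_apply_apply,
      tcoeff_zero_smul, tcoeff_tmul, tensorAct_smul, LinearMap.smul_apply, map_smul]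

/-- The left side is again a Whittaker vector, so comparing constant coefficients suffices. There
every term of the alternating sum with $r\ne0$ disappears and `D` itself is left. -/
lemma whAct_one_tmul (D : SbarGE) (v : V) :
    whAct (tensorObj a V) D.1 (tensorEquiv a V (1 ⊗ₜ v)) = tensorEquiv a V (1 ⊗ₜ ⁅D, v⁆) := by
  have h := whAct_mem a D.1 (one_tmul_mem_Wh a V v)
  rw [← (tensorEquiv a V).apply_symm_apply (whAct _ _ _), tensorEquiv_mem_Wh_iff] at h
  rw [← LinearEquiv.symm_apply_eq, h]
  congr 1
  rw [whAct, tcoeff_zero_smashAct, tcoeff_zero_taylor, tensorAct, LinearMap.add_apply, map_add,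
    tcoeff_zero_extAct, LinearMap.rTensor_tmul, tcoeff_tmul, cocycle_apply, tcoeff_lTensor,
    tcoeff_zero_taylor, projGE_of_mem, twistedField_apply]
  -- The fields in $\bar S_2^{\ge0}$ vanish at the origin, which removes the contribution of the
  -- twisted field.
  have h0 : ∀ i, coeff 0 (D.1.1 (X i)) = 0 := atOrigin_of_mem D.2
  simp [h0]

/-- The isomorphism `v ↦ 1 ⊗ v` of `S̄₂^{≥0}`-modules from `V` to `Wh_a(T(A₂^a, V))`. -/
noncomputable def unitHom (V : SbarGEFMod.{u}) (hV : isOmega a (tensorObj a V.obj)) :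
    V.obj →ₗ⁅ℂ, SbarGE⁆ (whObj a ⟨tensorObj a V.obj, hV⟩).obj where
  toLinearMap := toWh a V.obj
  map_lie' {x v} := Subtype.ext (whAct_one_tmul a V.obj x v).symm

end tensorObj

/-! ### Inversion of the Taylor expansion -/

/-- The `A₂`-linear map `f ⊗ D ↦ f • taylor (-1) D`. -/
noncomputable def taylorInv : A2 ⊗[ℂ] Sbar →ₗ[ℂ] A2 ⊗[ℂ] Sbar :=
  TensorProduct.lift ((Algebra.lsmul ℂ ℂ (A2 ⊗[ℂ] Sbar)).toLinearMap.compl₂ (taylorₗ (-1)))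

lemma taylorInv_tmul (f : A2) (D : Sbar) : taylorInv (f ⊗ₜ D) = f • taylor (-1) D := rfl

lemma rTensor_derivation_smul {L : Type*} [AddCommGroup L] [Module ℂ L] (D : W2) (f : A2)
    (z : A2 ⊗[ℂ] L) : LinearMap.rTensor L D.toLinearMap (f • z) =
      D f • z + f • LinearMap.rTensor L D.toLinearMap z := by
  induction z with
  | zero => simp
  | add a b ha hb => simp only [smul_add, map_add, ha, hb]; abel
  | tmul g v =>
    simp only [TensorProduct.smul_tmul', LinearMap.rTensor_tmul, Derivation.coeFn_coe,
      ← TensorProduct.add_tmul, Derivation.leibniz, smul_eq_mul]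
    congr 1; ring

/-- This is the Leibniz rule: the minus sign comes from differentiating `taylor (-1) D`, which gives
`-taylor (-1) (adPartial i D)`. -/
lemma pderiv_taylorInv (i : Fin 2) (z : A2 ⊗[ℂ] Sbar) :
    LinearMap.rTensor Sbar (pderiv i : W2).toLinearMap (taylorInv z) =
      taylorInv (LinearMap.rTensor Sbar (pderiv i : W2).toLinearMap z) -
        taylorInv (LinearMap.lTensor A2 (adPartial i) z) := by
  induction z with
  | zero => simp
  | add a b ha hb => simp only [map_add, ha, hb]; abel
  | tmul f D =>
    have h : ∀ y : A2 ⊗[ℂ] Sbar, f • ((-1 : ℂ) • y) = -(f • y) := fun y => by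
      rw [smul_comm]; exact neg_one_smul ℂ (f • y)
    rw [taylorInv_tmul, rTensor_derivation_smul, pderiv_taylor, lTensor_adPartial_taylor,
      LinearMap.rTensor_tmul, LinearMap.lTensor_tmul, taylorInv_tmul, taylorInv_tmul, h,
      sub_eq_add_neg]
    rfl

lemma tcoeff_zero_taylorInv (z : A2 ⊗[ℂ] Sbar) : tcoeff 0 (taylorInv z) = tcoeff 0 z := by
  induction z with
  | zero => simp
  | add a b ha hb => simp only [map_add, ha, hb]
  | tmul f D => rw [taylorInv_tmul, tcoeff_zero_smul, tcoeff_zero_taylor, tcoeff_tmul]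

/-- On `taylor 1 D` the polynomial derivative agrees with $\mathrm{ad}\,\partial_i$, so the two
terms of `pderiv_taylorInv` cancel and the result is constant in $t$. -/
lemma taylorInv_taylor (D : Sbar) : taylorInv (taylor 1 D) = 1 ⊗ₜ D := by
  rw [← sub_eq_zero]
  -- With $c=0$ the uniqueness statement says that an element with zero derivatives and zero
  -- constant coefficient vanishes.
  refine taylor_unique 0 _ ?_ fun i => ?_
  · rw [map_sub, tcoeff_zero_taylorInv, tcoeff_zero_taylor, tcoeff_tmul]; simp
  · rw [map_sub, pderiv_taylorInv, pderiv_taylor, one_smul, sub_self, LinearMap.rTensor_tmul]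
    simp

/-! ### The multiplication map $A_2\otimes W\to M$ and its injectivity -/

section counit
variable {M : Type u} [AddCommGroup M] [Module ℂ M] [LieRingModule Stilde M] [LieModule ℂ Stilde M]

lemma inS_eq_smashAct_taylorInv (hM : IsASModule M) (D : Sbar) (m : M) :
    ⁅inS D, m⁆ = smashAct M (taylorInv (taylor 1 D)) m := by
  rw [taylorInv_taylor, smashAct_tmul, hM.one_act]

section
variable {W : Type*} [AddCommGroup W] [Module ℂ W]

/-- The map `p ⊗ v ↦ p (j v)` from `A₂ ⊗ W` to `M`. -/
noncomputable def mulMap (j : W →ₗ[ℂ] M) : A2 ⊗[ℂ] W →ₗ[ℂ] M :=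
  TensorProduct.lift (((LieModule.toEnd ℂ Stilde M : Stilde →ₗ[ℂ] Module.End ℂ M) ∘ₗ
    (inA : A2 →ₗ[ℂ] Stilde)).compl₂ j)

lemma mulMap_tmul (j : W →ₗ[ℂ] M) (p : A2) (v : W) : mulMap j (p ⊗ₜ v) = ⁅inA p, j v⁆ := rfl

lemma mulMap_smul (hM : IsASModule M) (j : W →ₗ[ℂ] M) (f : A2) (w : A2 ⊗[ℂ] W) :
    mulMap j (f • w) = ⁅inA f, mulMap j w⁆ := by
  induction w with
  | zero => simp
  | add x y hx hy => simp only [smul_add, map_add, lie_add, hx, hy]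
  | tmul p v => rw [TensorProduct.smul_tmul', mulMap_tmul, mulMap_tmul, hM.mul_act, smul_eq_mul]

/-- Since $\partial_i-a_i$ kills the image of $j$, it differentiates only the polynomial factor. -/
lemma mulMap_pderiv {a : Fin 2 → ℂ} {j : W →ₗ[ℂ] M} (hj : ∀ v, j v ∈ Wh M a) (i : Fin 2)
    (w : A2 ⊗[ℂ] W) : mulMap j (LinearMap.rTensor W (pderiv i : W2).toLinearMap w) =
      ⁅inS (partialS i), mulMap j w⁆ - a i • mulMap j w := by
  induction w with
  | zero => simp
  | add x y hx hy => simp only [map_add, lie_add, smul_add, hx, hy]; abel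
  | tmul p v =>
    rw [LinearMap.rTensor_tmul, mulMap_tmul, mulMap_tmul, inS_inA, mem_Wh_iff.1 (hj v) i,
      lie_smul, add_sub_cancel_right]
    rfl

/-- The kernel is stable under the derivatives. By induction on the degree the derivatives of a
kernel element vanish, so the element is constant, and on constants the map is $j$. -/
lemma mulMap_injective (hM : IsASModule M) {a : Fin 2 → ℂ} {j : W →ₗ[ℂ] M}
    (hj : ∀ v, j v ∈ Wh M a) (hinj : Function.Injective j) : Function.Injective (mulMap j) := by
  rw [injective_iff_map_eq_zero]
  intro w hw
  obtain ⟨n, hn⟩ := exists_mem_degreeLT w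
  induction n generalizing w with
  | zero => exact eq_zero_of_mem_degreeLT_zero hn
  | succ n ih =>
    have h : w = 1 ⊗ₜ tcoeff 0 w := eq_one_tmul_of_pderiv_eq_zero fun i =>
      ih _ (by rw [mulMap_pderiv hj, hw, lie_zero, smul_zero, sub_zero]) (pderiv_mem_degreeLT hn i)
    rw [h, mulMap_tmul, hM.one_act, map_eq_zero_iff j hinj] at hw
    rw [h, hw, TensorProduct.tmul_zero]

end

/-! ### Locally nilpotent $\partial_i-a_i$ and surjectivity -/

/-- If `[θ, τ] = 1` and `θ u = 0`, then `θⁿ τⁿ u = n! u`. -/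
lemma pow_apply_pow_apply_of_commutator_eq_one {R N : Type*} [CommRing R] [AddCommGroup N]
    [Module R N] {θ τ : Module.End R N} (h : θ * τ = τ * θ + 1) {u : N} (hu : θ u = 0) (n : ℕ) :
    (θ ^ n) ((τ ^ n) u) = (n.factorial : R) • u := by
  -- On the span of the $\tau^nu$, $\theta$ acts as $d/d\tau$.
  have hs : ∀ n : ℕ, θ ((τ ^ (n + 1)) u) = ((n + 1 : ℕ) : R) • (τ ^ n) u := by
    intro n
    induction n with
    | zero =>
      have := LinearMap.congr_fun h u
      simpa [hu] using this
    | succ n ih =>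
      have := LinearMap.congr_fun h ((τ ^ (n + 1)) u)
      simp only [Module.End.mul_apply, LinearMap.add_apply, Module.End.one_apply, ih,
        map_smul] at this
      rw [pow_succ' τ (n + 1), Module.End.mul_apply, this, ← Module.End.mul_apply, ← pow_succ']
      push_cast
      rw [add_smul (_ + 1 : R), one_smul]
  induction n with
  | zero => simp
  | succ n ih =>
    rw [pow_succ, Module.End.mul_apply, hs, map_smul, ih, smul_smul, Nat.factorial_succ]
    push_cast
    rfl

/-- If `[θ, τ] = 1`, a `τ`-stable subspace that contains the kernel of `θ` on `K` contains every
vector of `K` killed by a power of `θ`. -/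
lemma mem_of_pow_apply_eq_zero {R N : Type*} [Field R] [CharZero R] [AddCommGroup N]
    [Module R N] {θ τ : Module.End R N} (h : θ * τ = τ * θ + 1) {K S : Submodule R N}
    (hKθ : ∀ m ∈ K, θ m ∈ K) (hKτ : ∀ m ∈ K, τ m ∈ K) (hSτ : ∀ m ∈ S, τ m ∈ S)
    (hKS : ∀ m ∈ K, θ m = 0 → m ∈ S) (n : ℕ) {m : N} (hm : m ∈ K) (hn : (θ ^ n) m = 0) :
    m ∈ S := by
  have hpow : ∀ (φ : Module.End R N) (P : Submodule R N), (∀ m ∈ P, φ m ∈ P) →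
      ∀ (k : ℕ), ∀ m ∈ P, (φ ^ k) m ∈ P := by
    intro φ P hP k
    induction k with
    | zero => intro m hm; simpa using hm
    | succ k ih =>
      intro m hm
      rw [pow_succ', Module.End.mul_apply]
      exact hP _ (ih m hm)
  induction n generalizing m with
  | zero =>
    rw [pow_zero, Module.End.one_apply] at hn
    rw [hn]; exact zero_mem _
  | succ n ih =>
    set u := (θ ^ n) m with hu
    have huK : u ∈ K := hpow θ K hKθ n m hm
    have hθu : θ u = 0 := by rwa [pow_succ', Module.End.mul_apply] at hn
    -- The subtracted vector has the same image $u$ under $\theta^n$ as $m$, so $\theta^n$ kills the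
    -- difference and the induction hypothesis applies to it.
    have h1 : m - (n.factorial : R)⁻¹ • (τ ^ n) u ∈ S := by
      refine ih (sub_mem hm (Submodule.smul_mem _ _ (hpow τ K hKτ n u huK))) ?_
      rw [map_sub, map_smul, pow_apply_pow_apply_of_commutator_eq_one h hθu, smul_smul,
        inv_mul_cancel₀ (Nat.cast_ne_zero.2 n.factorial_ne_zero), one_smul, ← hu, sub_self]
    have h2 := add_mem h1
      (S.smul_mem (n.factorial : R)⁻¹ (hpow τ S hSτ n u (hKS u huK hθu)))
    rwa [sub_add_cancel] at h2

variable (M) in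
/-- The operator `∂_i - a_i` on an `S̃₂`-module. -/
noncomputable def shiftedPartial (a : Fin 2 → ℂ) (i : Fin 2) : Module.End ℂ M :=
  LieModule.toEnd ℂ Stilde M (inS (partialS i)) - a i • 1

lemma shiftedPartial_apply (a : Fin 2 → ℂ) (i : Fin 2) (m : M) :
    shiftedPartial M a i m = ⁅inS (partialS i), m⁆ - a i • m := rfl

lemma shiftedPartial_inA (a : Fin 2 → ℂ) (i : Fin 2) (f : A2) (m : M) :
    shiftedPartial M a i ⁅inA f, m⁆ = ⁅inA (pderiv i f), m⁆ + ⁅inA f, shiftedPartial M a i m⁆ := by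
  rw [shiftedPartial_apply, shiftedPartial_apply, inS_inA, lie_sub, lie_smul, add_sub_assoc]
  rfl

lemma shiftedPartial_comm (a : Fin 2 → ℂ) (i j : Fin 2) (m : M) :
    shiftedPartial M a i (shiftedPartial M a j m) =
      shiftedPartial M a j (shiftedPartial M a i m) := by
  have h : ⁅partialS i, partialS j⁆ = 0 := adPartial_partial i j
  simp only [shiftedPartial_apply, lie_sub, smul_sub, lie_smul]
  rw [leibniz_lie (inS (partialS i)), ← LieHom.map_lie, h, map_zero, zero_lie, zero_add,
    smul_comm (a i) (a j)]
  abel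

lemma shiftedPartial_mul_X (hM : IsASModule M) (a : Fin 2 → ℂ) (i : Fin 2) :
    shiftedPartial M a i * LieModule.toEnd ℂ Stilde M (inA (X i)) =
      LieModule.toEnd ℂ Stilde M (inA (X i)) * shiftedPartial M a i + 1 := by
  refine LinearMap.ext fun m => ?_
  change shiftedPartial M a i ⁅inA (X i), m⁆ = ⁅inA (X i), shiftedPartial M a i m⁆ + m
  rw [shiftedPartial_inA, pderiv_X_self, hM.one_act, add_comm]

/-- The one-variable lemma is applied twice to the range of `mulMap j`. Inside $\ker\theta_1$ it
reduces to Whittaker vectors by means of $\theta_2$ and $t_2$; on all of $M$ it then reduces to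
$\ker\theta_1$ by means of $\theta_1$ and $t_1$. -/
lemma mulMap_surjective {W : Type*} [AddCommGroup W] [Module ℂ W] (hM : IsASModule M)
    {a : Fin 2 → ℂ} (hT : IsOfType M a) {j : W →ₗ[ℂ] M} (hj : ∀ m ∈ Wh M a, ∃ v, j v = m) :
    Function.Surjective (mulMap j) := by
  have hnil : ∀ (i : Fin 2) (m : M), ∃ k, (shiftedPartial M a i ^ k) m = 0 := by
    intro i m
    have h := hT m ⟨partialS i, partialS_mem i⟩
    rwa [phi_partialS] at h
  have hX : ∀ (i : Fin 2), ∀ m ∈ LinearMap.range (mulMap j),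
      ⁅inA (X i), m⁆ ∈ LinearMap.range (mulMap j) := by
    rintro i _ ⟨w, rfl⟩
    exact ⟨(X i : A2) • w, mulMap_smul hM j _ w⟩
  have hker : ∀ m, shiftedPartial M a 0 m = 0 → m ∈ LinearMap.range (mulMap j) := by
    intro m hm
    obtain ⟨k, hk⟩ := hnil 1 m
    -- The kernel of the first operator is stable under the second operator and under $t_2$, because
    -- both commute with the first.
    refine mem_of_pow_apply_eq_zero (shiftedPartial_mul_X hM a 1)
      (K := LinearMap.ker (shiftedPartial M a 0)) ?_ ?_ (hX 1) ?_ k hm hk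
    · intro m hm
      rw [LinearMap.mem_ker] at hm ⊢
      rw [shiftedPartial_comm, hm, map_zero]
    · intro m hm
      rw [LinearMap.mem_ker] at hm ⊢
      rw [LieModule.toEnd_apply_apply, shiftedPartial_inA, hm, pderiv_X_of_ne (by decide),
        map_zero, zero_lie, lie_zero, add_zero]
    · intro m h0 h1
      have hm : m ∈ Wh M a := by
        refine mem_Wh_iff.2 fun i => ?_
        rw [← sub_eq_zero, ← shiftedPartial_apply]
        fin_cases i
        · exact h0
        · exact h1
      obtain ⟨v, hv⟩ := hj m hm
      exact ⟨1 ⊗ₜ v, by rw [mulMap_tmul, hM.one_act, hv]⟩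
  intro m
  obtain ⟨k, hk⟩ := hnil 0 m
  exact mem_of_pow_apply_eq_zero (shiftedPartial_mul_X hM a 0) (K := ⊤) (fun _ _ => trivial)
    (fun _ _ => trivial) (hX 0) (fun m _ h => hker m h) k (Submodule.mem_top) hk

/-! ### Compatibility of multiplication with the action of $\bar S_2$ -/

/-- The inversion fixes $1\otimes\partial_i$, so the constant parts act as $\sum_ip_i\partial_i$,
and $\partial_i$ is the scalar $a_i$ on $m$. This is the term of order zero in `twistedField`. -/
lemma smashAct_taylorInv_constPart (hM : IsASModule M) {a : Fin 2 → ℂ} (D : Sbar) {m : M}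
    (hm : m ∈ Wh M a) :
    smashAct M (taylorInv (constPart D)) m = ⁅inA (∑ i, a i • D.1 (X i)), m⁆ := by
  simp only [constPart, map_sum, LinearMap.sum_apply, taylorInv_tmul, taylor_partialS,
    ← inA_smashAct hM, smashAct_tmul, mem_Wh_iff.1 hm, lie_smul, sum_lie, map_smul, smul_lie,
    hM.one_act]
  rfl

section
variable {W : Type*} [AddCommGroup W] [Module ℂ W] [LieRingModule SbarGE W] [LieModule ℂ SbarGE W]
  {j : W →ₗ[ℂ] M}

lemma mulMap_extAct (hM : IsASModule M)
    (hlie : ∀ (x : SbarGE) (v : W), j ⁅x, v⁆ = whAct M x.1 (j v))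
    (z : A2 ⊗[ℂ] SbarGE) (v : W) : mulMap j (extAct SbarGE W z (1 ⊗ₜ v)) =
      smashAct M (taylorInv (LinearMap.lTensor A2 SbarGE.toSubmodule.subtype z)) (j v) := by
  induction z with
  | zero => simp
  | add x y hx hy => simp only [map_add, LinearMap.add_apply, hx, hy]
  | tmul f D =>
    rw [extAct_tmul, mul_one, LinearMap.lTensor_tmul, taylorInv_tmul, ← inA_smashAct hM,
      mulMap_tmul, hlie]
    rfl

/-- On $1\otimes v$ the twisted field and the cocycle match the two summands of `taylor_decomp`, and
`taylorInv` reassembles them into $D$. -/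
lemma mulMap_tensorAct (hM : IsASModule M) {a : Fin 2 → ℂ} (hj : ∀ v, j v ∈ Wh M a)
    (hlie : ∀ (x : SbarGE) (v : W), j ⁅x, v⁆ = whAct M x.1 (j v))
    (D : Sbar) (w : A2 ⊗[ℂ] W) :
    mulMap j (tensorAct a W D w) = ⁅inS D, mulMap j w⁆ := by
  induction w with
  | zero => simp
  | add x y hx hy => simp only [map_add, lie_add, hx, hy]
  | tmul p v =>
    have h1 : mulMap j (tensorAct a W D (1 ⊗ₜ v)) = ⁅inS D, j v⁆ := by
      rw [tensorAct, LinearMap.add_apply, map_add, mulMap_extAct hM hlie, LinearMap.rTensor_tmul,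
        mulMap_tmul, twistedField_apply, Derivation.map_one_eq_zero, zero_add, mul_one,
        ← smashAct_taylorInv_constPart hM D (hj v), ← LinearMap.add_apply, ← map_add, ← map_add,
        add_comm, ← taylor_decomp, ← inS_eq_smashAct_taylorInv hM]
    -- Both sides obey the same Leibniz rule in $p$, which extends the case $p=1$.
    rw [show p ⊗ₜ[ℂ] v = p • ((1 : A2) ⊗ₜ[ℂ] v) by rw [TensorProduct.smul_tmul', smul_eq_mul,
      mul_one], tensorAct_smul_A2, map_add, mulMap_smul hM, mulMap_smul hM, mulMap_smul hM, h1,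
      mulMap_tmul, hM.one_act, inS_inA]

end

end counit

/-! ### Unit, counit and the equivalence -/

section equivalence
variable (a : Fin 2 → ℂ)

/-- The underlying map of the inclusion of `Wh_a(M)` in `M`. -/
noncomputable def whInclusion (M : Omega.{u} a) : (whObj a M).obj →ₗ[ℂ] M.obj :=
  (Wh M.obj a).subtype

/-- The isomorphism `p ⊗ v ↦ p v` from `T(A₂^a, Wh_a(M))` to `M`. -/
noncomputable def counitHom (M : Omega.{u} a) :
    tensorObj a (whObj a M).obj →ₗ⁅ℂ, Stilde⁆ M.obj where
  toLinearMap := mulMap (whInclusion a M)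
  map_lie' := by
    intro s (w : A2 ⊗[ℂ] (whObj a M).obj)
    have hs : s = inA s.left + inS s.right :=
      LieAlgebra.SemiDirectSum.ext (add_zero _).symm (zero_add _).symm
    change mulMap (whInclusion a M) (s.left • w + tensorAct a (whObj a M).obj s.right w) =
      ⁅s, mulMap (whInclusion a M) w⁆
    -- The final `rfl` argument holds because the action on $\mathrm{Wh}_{\mathbf a}(M)$ is `whAct`
    -- by definition.
    rw [map_add, mulMap_smul M.property.isAS,
      mulMap_tensorAct M.property.isAS (fun v => v.2) (fun _ _ => rfl), ← add_lie, ← hs]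

lemma counitHom_bijective (M : Omega.{u} a) : Function.Bijective (counitHom a M) :=
  ⟨mulMap_injective M.property.isAS (j := whInclusion a M) (fun v => v.2)
    Subtype.val_injective,
   mulMap_surjective M.property.isAS M.property.isOfType (j := whInclusion a M)
    fun m hm => ⟨⟨m, hm⟩, rfl⟩⟩

/-- A bijective homomorphism of modules is an isomorphism. -/
noncomputable def LieModCat.isoOfBijective {L : Type w} [LieRing L] [LieAlgebra ℂ L]
    {M N : LieModCat.{w, u} L} (f : M →ₗ⁅ℂ, L⁆ N) (hf : Function.Bijective f) : M ≅ N where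
  hom := f
  inv := f.inverse (Function.surjInv hf.2) (Function.leftInverse_surjInv hf)
    (Function.rightInverse_surjInv hf.2)
  hom_inv_id := LieModuleHom.ext (Function.leftInverse_surjInv hf)
  inv_hom_id := LieModuleHom.ext (Function.rightInverse_surjInv hf.2)

lemma isOmega_tensorFunctor (V : SbarGEFMod.{u}) :
    isOmega.{u} a ((tensorFunctor.{u} a).obj V.obj) :=
  have : FiniteDimensional ℂ V.obj := V.property
  isOmega_tensorObj a V.obj

/-- The functor `V ↦ T(A₂^a, V)` from finite-dimensional `S̄₂^{≥0}`-modules to `Ω_a`. -/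
noncomputable abbrev tensorFunctorOmega : SbarGEFMod.{u} ⥤ Omega.{u} a :=
  (isOmega.{u} a).lift (isFiniteDimensional.{u}.ι ⋙ tensorFunctor.{u} a) (isOmega_tensorFunctor a)

/-- The natural isomorphism `V ≅ Wh_a(T(A₂^a, V))`. -/
noncomputable def unitNatIso :
    𝟭 SbarGEFMod.{u} ≅ tensorFunctorOmega a ⋙ whittakerFunctor.{u} a :=
  NatIso.ofComponents
    (fun V => isFiniteDimensional.isoMk
      (LieModCat.isoOfBijective (unitHom a V (isOmega_tensorFunctor a V)) (toWh_bijective a V.obj)))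
    (fun _ => rfl)

/-- The natural isomorphism `T(A₂^a, Wh_a(M)) ≅ M`. -/
noncomputable def counitNatIso :
    whittakerFunctor.{u} a ⋙ tensorFunctorOmega a ≅ 𝟭 (Omega.{u} a) :=
  NatIso.ofComponents
    (fun M => (isOmega a).isoMk
      (LieModCat.isoOfBijective (counitHom a M) (counitHom_bijective a M)))
    (fun {M N} f => by
      apply ObjectProperty.hom_ext
      refine LieModuleHom.ext fun (w : A2 ⊗[ℂ] (whObj a M).obj) => ?_
      change mulMap (whInclusion a N) (LinearMap.lTensor A2 (whMap a f.hom).toLinearMap w) =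
        LieModuleHom.toLinearMap f.hom (mulMap (whInclusion a M) w)
      induction w with
      | zero => simp only [map_zero]
      | add x y hx hy => simp only [map_add, hx, hy]
      -- On pure tensors naturality is the $A_2$-linearity of $f$.
      | tmul p v => exact (LieModuleHom.map_lie f.hom (inA p) (whInclusion a M v)).symm)

end equivalence

end WhittakerS2

theorem theorem3 (a : Fin 2 → ℂ) :
    ∃ (h : ∀ V : WhittakerS2.SbarGEFMod.{u},
        WhittakerS2.isOmega.{u} a ((WhittakerS2.tensorFunctor.{u} a).obj V.obj))
      (e : CategoryTheory.Equivalence WhittakerS2.SbarGEFMod.{u} (WhittakerS2.Omega.{u} a)),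
      e.functor = (WhittakerS2.isOmega.{u} a).lift
        (WhittakerS2.isFiniteDimensional.{u}.ι.comp (WhittakerS2.tensorFunctor.{u} a)) h ∧
      e.inverse = WhittakerS2.whittakerFunctor.{u} a :=
  ⟨WhittakerS2.isOmega_tensorFunctor a,
    -- This constructor adjusts only the unit, to obtain the triangle identity, so both functors are
    -- the given ones definitionally.
    CategoryTheory.Equivalence.mk (WhittakerS2.tensorFunctorOmega a)
      (WhittakerS2.whittakerFunctor a) (WhittakerS2.unitNatIso a) (WhittakerS2.counitNatIso a),
    rfl, rfl⟩
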